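/- Let $d\ge 2$ and let $h$ be a $\{0,1\}$-valued function on the non-empty finite subsets of $\mathbb{R}^d$ such that: $(x_0,\dots,x_k)\mapsto h(\{x_0,\dots,x_k\})$ is Borel measurable for every $k$; $h(\{x\})=1$ for every $x$; $h(\mathcal X)\le h(\mathcal Y)$ whenever $\emptyset\neq\mathcal Y\subset\mathcal X$; $h(\mathcal X+y)=h(\mathcal X)$ for all $y\in\mathbb{R}^d$; there is $c>0$ with $h(\mathcal X)=0$ whenever $\mathrm{diam}(\mathcal X)>c$; and, with $h_t(\mathcal X):=h(t^{-1}\mathcal X)$ for $t>0$, $h_s\le h_t$ for all $0<s\le t$. For $t=0$ let $h_0(\mathcal X):=\lim_{t\downarrow 0}h_t(\mathcal X)=\mathbf 1\{|\mathcal X|=1\}$. Write $h_t(x_0,\dots,x_k):=h_t(\{x_0,\dots,x_k\})$. Let $X_1,X_2,\dots$ be i.i.d. random points in $\mathbb{R}^d$ with a probability density $f$ that is spherically symmetric, and write $f(r):=f(r\theta)$ for $r\ge 0$, $\|\theta\|=1$ (Euclidean norm). Assume that for some $\alpha>d$, $\lim_{r\to\infty}f(rt)/f(r)=t^{-\alpha}$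 for every $t>0$. Let $(R_n)$ be a non-random sequence with $R_n\to\infty$ and $nf(R_n)\to\xi$ for some $\xi\in(0,\infty)$. Put $\mathcal X_n=\{X_1,\dots,X_n\}$ and, for $t\ge 0$, $$\chi_n(t)=\sum_{k=0}^\infty(-1)^kS_{k,n}(t),\qquad S_{k,n}(t)=\sum_{\mathcal Y\subset\mathcal X_n,\ |\mathcal Y|=k+1}h_t(\mathcal Y)\,\mathbf 1\Big\{\min_{y\in\mathcal Y}\|y\|\ge R_n\Big\},$$ which is the Euler characteristic of the complex $\{\mathcal Y\subset\mathcal X_n\cap B(0,R_n)^c:\ h_t(\mathcal Y)=1\}$, where $B(0,R)$ is the open ball. Let $s_{d-1}=d\,\lambda(B(0,1))$ be the surface area of the unit sphere ($\lambda$ is Lebesgue measure), and for $t\ge0$ let $s_0(t)=s_{d-1}\xi/(\alpha-d)$ and $$s_k(t)=\frac{s_{d-1}\,\xi^{k+1}}{(k+1)!\,(\alpha(k+1)-d)}\int_{(\mathbb{R}^d)^k}h_t(0,y_1,\dots,y_k)\,dy_1\cdots dy_k,\qquad k\ge1.$$ Then these integrals are finite, the series $\sum_{k=0}^\infty(-1)^ks_k(t)$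 converges absolutely for every $t\ge0$, its sum belongs to the space $D[0,\infty)$ of right-continuous functions with left limits, and almost surely, as $n\to\infty$, $$\sup_{0\le t\le T}\bigg|\frac{\chi_n(t)}{R_n^d}-\sum_{k=0}^\infty(-1)^ks_k(t)\bigg|\to0\qquad\text{for every }0\le T<\infty.$$ If moreover $t\mapsto h_t(\mathcal X)$ is right-continuous on $(0,\infty)$ for every $\mathcal X$, then the paths of all $\chi_n$ belong to $D[0,\infty)$, so that this is almost sure convergence in $D[0,\infty)$ for uniform convergence on compact sets. -/

import Mathlib

open Set Filter Topology MeasureTheory ProbabilityTheory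

noncomputable section

namespace GeomComplex

/-- The Euclidean space `ℝ^d` (with the Euclidean norm and Lebesgue measure). -/
abbrev E (d : ℕ) : Type := EuclideanSpace ℝ (Fin d)

open Classical in
/-- The finite point set `{x_i : i}` underlying a finite tuple of points (coincidences collapse). -/
def pointSet {d : ℕ} {ι : Type*} [Fintype ι] (x : ι → E d) : Finset (E d) :=
  Finset.univ.image x

open Classical in
/-- The translated point set `𝒳 + y`. -/
def translate {d : ℕ} (𝒳 : Finset (E d)) (y : E d) : Finset (E d) :=
  𝒳.image (fun x => x + y)

open Classical in
/-- The dilated point set `a𝒳`. -/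
def dilate {d : ℕ} (a : ℝ) (𝒳 : Finset (E d)) : Finset (E d) :=
  𝒳.image (fun x => a • x)

/-- The scaled indicator `h_t(𝒳) = h(t⁻¹𝒳)` for `t > 0`. At `t = 0` the expression `t⁻¹𝒳` has no
meaning; `h_0(𝒳)` is the indicator that `𝒳` is a single point, which is the limit of `h_t(𝒳)` as
`t ↓ 0` for every locally determined `h` with value `1` on singletons. Negative `t` are
irrelevant. -/
def scaled {d : ℕ} (h : Finset (E d) → ℝ) (t : ℝ) (𝒳 : Finset (E d)) : ℝ :=
  if t = 0 then (if 𝒳.card = 1 then 1 else 0) else h (dilate t⁻¹ 𝒳)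

/-- The admissible indicator functions `h` on non-empty finite subsets of `ℝ^d`, used to build
geometric complexes (the value of `h` at the empty set is irrelevant). -/
structure IsAdmissible {d : ℕ} (h : Finset (E d) → ℝ) : Prop where
  /-- `h` takes values in `{0, 1}`. -/
  zero_or_one : ∀ 𝒳 : Finset (E d), 𝒳.Nonempty → h 𝒳 = 0 ∨ h 𝒳 = 1
  /-- Every single point is a `0`-simplex, i.e. `h` does not vanish identically. -/
  singleton : ∀ x : E d, h {x} = 1
  /-- `h(x_0, …, x_k)` is a Borel function of `(x_0, …, x_k)`. -/
  measurable : ∀ k : ℕ, Measurable (fun x : Fin (k + 1) → E d => h (pointSet x))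
  /-- `h` is non-increasing under inclusion, so that the complexes are closed under faces. -/
  anti : ∀ 𝒴 𝒳 : Finset (E d), 𝒴.Nonempty → 𝒴 ⊆ 𝒳 → h 𝒳 ≤ h 𝒴
  /-- `h` is translation invariant. -/
  translation : ∀ (𝒳 : Finset (E d)) (y : E d), 𝒳.Nonempty → h (translate 𝒳 y) = h 𝒳
  /-- `h` is locally determined. -/
  loc : ∃ c : ℝ, 0 < c ∧ ∀ 𝒳 : Finset (E d), 𝒳.Nonempty →
    c < Metric.diam (𝒳 : Set (E d)) → h 𝒳 = 0
  /-- `h_s ≤ h_t` for `s ≤ t`, so that the complexes form a filtration. -/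
  scaled_mono : ∀ (s t : ℝ) (𝒳 : Finset (E d)), 0 < s → s ≤ t → 𝒳.Nonempty →
    scaled h s 𝒳 ≤ scaled h t 𝒳

/-- The sample point set consisting of the first `n` points of the sequence. -/
def sample {d : ℕ} {Ω : Type*} (X : ℕ → Ω → E d) (n : ℕ) (ω : Ω) : Finset (E d) :=
  pointSet (fun i : Fin n => X i ω)

open Classical in
/-- The number `S_{k,n}(t)` of `k`-simplices of the complex
`{𝒴 ⊆ 𝒳_n ∩ B(0,R)ᶜ : h_t(𝒴) = 1}` built on the sample points outside the open ball `B(0, R)`. -/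
def simplexCount {d : ℕ} {Ω : Type*} (h : Finset (E d) → ℝ) (X : ℕ → Ω → E d) (R : ℝ)
    (k n : ℕ) (t : ℝ) (ω : Ω) : ℝ :=
  ∑ 𝒴 ∈ (sample X n ω).powersetCard (k + 1),
    scaled h t 𝒴 * (if ∀ y ∈ 𝒴, R ≤ ‖y‖ then 1 else 0)

/-- The Euler characteristic `χ_n(t) = ∑_k (-1)^k S_{k,n}(t)` of the complex outside `B(0, R_n)`
(all terms with `k ≥ n` vanish). -/
def eulerChar {d : ℕ} {Ω : Type*} (h : Finset (E d) → ℝ) (X : ℕ → Ω → E d) (R : ℕ → ℝ)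
    (n : ℕ) (t : ℝ) (ω : Ω) : ℝ :=
  ∑' k : ℕ, (-1 : ℝ) ^ k * simplexCount h X (R n) k n t ω

open Classical in
/-- The function `(y_1, …, y_k) ↦ h_t(0, y_1, …, y_k)` on `(ℝ^d)^k`. -/
def hZero {d : ℕ} (h : Finset (E d) → ℝ) (k : ℕ) (t : ℝ) (y : Fin k → E d) : ℝ :=
  scaled h t (insert 0 (pointSet y))

/-- The surface area `s_{d-1} = d ω_d` of the unit sphere, `ω_d` the volume of the unit ball. -/
def sphereArea (d : ℕ) : ℝ := d * volume.real (Metric.ball (0 : E d) 1)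

/-- The functions `s_k(t)` in the limit. -/
def sLim {d : ℕ} (h : Finset (E d) → ℝ) (α ξ : ℝ) (k : ℕ) (t : ℝ) : ℝ :=
  if k = 0 then sphereArea d * ξ / (α - d)
  else sphereArea d * ξ ^ (k + 1) / ((k + 1).factorial * (α * (k + 1) - d)) *
    ∫ y : Fin k → E d, hZero h k t y

/-- The limit function `∑_k (-1)^k s_k(t)`. -/
def limitFun {d : ℕ} (h : Finset (E d) → ℝ) (α ξ : ℝ) (t : ℝ) : ℝ :=
  ∑' k : ℕ, (-1 : ℝ) ^ k * sLim h α ξ k t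

/-- The restriction of `x` to `[0, ∞)` belongs to `D[0, ∞)`: it is right continuous and has left
limits. -/
def IsCadlag (x : ℝ → ℝ) : Prop :=
  (∀ t : ℝ, 0 ≤ t → ContinuousWithinAt x (Ici t) t) ∧
    ∀ t : ℝ, 0 < t → ∃ l : ℝ, Tendsto x (𝓝[<] t) (𝓝 l)

/-- `f` is a spherically symmetric probability density on `ℝ^d`. -/
structure IsSphericalDensity {d : ℕ} (f : E d → ℝ) : Prop where
  measurable : Measurable f
  nonneg : ∀ x, 0 ≤ f x
  total : ∫⁻ x, ENNReal.ofReal (f x) = 1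
  symm : ∀ x y, ‖x‖ = ‖y‖ → f x = f y

/-- `f` has a regularly varying tail with exponent `-α` along every ray. -/
def HasRegVarTail {d : ℕ} (f : E d → ℝ) (α : ℝ) : Prop :=
  ∀ θ : E d, ‖θ‖ = 1 → ∀ t : ℝ, 0 < t →
    Tendsto (fun r : ℝ => f ((r * t) • θ) / f (r • θ)) atTop (𝓝 (t ^ (-α)))

end GeomComplex

end

/-!
The Euler characteristic is an alternating sum of simplex counts `S_k`, and each `S_k(t)` is
monotone in `t` while its limit `s_k(t) = t ^ (d * k) * s_k(1)` is continuous. So it is enough to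
prove a strong law for each `k` and each rational `t`, together with a bound, uniform in `n`, on
the number of simplices of high dimension (`tendstoUniformlyOn_eulerChar`).

*Means.* The probability that `k + 1` given sample points form a simplex outside the ball of radius
`ρ` is an integral over a vertex and the bounded differences from it to the other vertices.
Rescaling the vertex by `ρ`, all vertices are seen at the same position, and the integral is
asymptotic to `ρ ^ d * f(ρ) ^ (k + 1)` times a constant (`tendsto_simplexIntegral`). Dominated
convergence is justified by the uniform convergence theorem of regular variation and by Potter's
bounds (`RegVar.eventually_increment_lt`, `RegVar.potter`).

*Fluctuations.* Only intersecting index sets contribute to the variance of a simplex count. The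
pairs with a common index `i` number at most `4 ^ D_i`, where `D_i` is the number of sample points
near the `i`-th one, and the mean of `∑ i, 4 ^ D_i` over the points outside the ball is `O(ρ ^ d)`
since the density there is `O(1 / n)` (`IsSample.variance_faceCount_le`,
`exists_integral_degreeWeight_le`). The same sum bounds the number of simplices of dimension at
least `K`, with a factor `2 ^ (-K)` (`faceCount_highFaces_le`).

*Almost sure convergence.* A variance of order `ρ ^ d` may be too large for summability over all
`n`, because `R_n ^ d` can grow like a small power of `n`; along a geometric sequence of sample
sizes it suffices. Within a block of indices between two consecutive terms of that sequence, the
counts are compared with those for the extreme sample sizes and the extreme radii of the block,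
using that counts increase with the sample and decrease with the radius. As the least radius of the
block also has the least power `R ^ d`, the normalisation goes in the right direction, and the
comparison costs only a power of the ratio of the geometric sequence
(`ae_eventually_faceCount_le`, `ae_eventually_le_faceCount`).
-/

/-! ### Regular variation: uniform convergence and Potter bounds -/

namespace RegVar

/-- The set of increments `u ∈ [0, 2]` for which `k (x + u)` is `ε`-far from `k x`. -/
def badSet (k : ℝ → ℝ) (ε x : ℝ) : Set ℝ := {u | u ∈ Icc (0 : ℝ) 2 ∧ ε ≤ |k (x + u) - k x|}

lemma measurableSet_badSet {k : ℝ → ℝ} (hk : Measurable k) (ε x : ℝ) :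
    MeasurableSet (badSet k ε x) := by
  have : Measurable fun u => |k (x + u) - k x| := by fun_prop
  exact measurableSet_Icc.inter (measurableSet_le measurable_const this)

lemma tendsto_volume_badSet {k : ℝ → ℝ} (hk : Measurable k)
    (h : ∀ u, Tendsto (fun x => k (x + u) - k x) atTop (𝓝 0)) {ε : ℝ} (hε : 0 < ε) :
    Tendsto (fun x => volume (badSet k ε x)) atTop (𝓝 0) := by
  have e : ∀ x, volume (badSet k ε x)
      = ∫⁻ u, (badSet k ε x).indicator (fun _ => 1) u := by
    intro x
    rw [lintegral_indicator (measurableSet_badSet hk ε x)]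
    simp
  simp_rw [e]
  have := tendsto_lintegral_filter_of_dominated_convergence (l := (atTop : Filter ℝ))
    (μ := (volume : Measure ℝ)) (F := fun x u => (badSet k ε x).indicator (fun _ => 1) u)
    (f := fun _ => 0) ((Icc (0 : ℝ) 2).indicator (fun _ => 1)) ?_ ?_ ?_ ?_
  · simpa using this
  · exact Eventually.of_forall fun x =>
      (measurable_const.indicator (measurableSet_badSet hk ε x))
  · refine Eventually.of_forall fun x => Eventually.of_forall fun u => ?_
    exact indicator_le_indicator_of_subset (fun u hu => hu.1) (fun _ => zero_le) u
  · rw [lintegral_indicator measurableSet_Icc]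
    simp
  · refine Eventually.of_forall fun u => ?_
    refine tendsto_const_nhds.congr' ?_
    have := (h u).abs
    rw [abs_zero] at this
    filter_upwards [this.eventually_lt_const hε] with x hx
    rw [indicator_of_notMem]
    exact fun hu => absurd hu.2 (not_le.2 hx)

/-- Uniform convergence theorem of regular variation, in additive form. The increments `w` with
`|k (x + w) - k x|` large, and those with `|k (x + w) - k (x + u)|` large, have small measure, so
some `w ∈ [1, 2]` connects `x` to `x + u`. -/
lemma eventually_increment_lt {k : ℝ → ℝ} (hk : Measurable k)
    (h : ∀ u, Tendsto (fun x => k (x + u) - k x) atTop (𝓝 0)) {ε : ℝ} (hε : 0 < ε) :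
    ∀ᶠ x in atTop, ∀ u ∈ Icc (0 : ℝ) 1, |k (x + u) - k x| < ε := by
  have h3 : (0 : ENNReal) < ENNReal.ofReal (1 / 3) := by simp
  obtain ⟨x₀, hx₀⟩ := eventually_atTop.1
    ((tendsto_volume_badSet hk h (half_pos hε)).eventually_lt_const h3)
  filter_upwards [eventually_ge_atTop x₀] with x hx u hu
  have h1 := hx₀ x hx
  have h2 := hx₀ (x + u) (by linarith [hu.1])
  obtain ⟨w, hw, hw'⟩ : ∃ w ∈ Icc (1 : ℝ) 2,
      w ∉ badSet k (ε / 2) x ∪ (fun w => w + -u) ⁻¹' badSet k (ε / 2) (x + u) := by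
    by_contra! hcon
    have hle : volume (Icc (1 : ℝ) 2) ≤ _ := (measure_mono hcon).trans (measure_union_le _ _)
    rw [measure_preimage_add_right, Real.volume_Icc] at hle
    have hlt := hle.trans_lt (ENNReal.add_lt_add h1 h2)
    rw [← ENNReal.ofReal_add (by norm_num) (by norm_num)] at hlt
    have := (ENNReal.ofReal_lt_ofReal_iff (by norm_num)).1 hlt
    norm_num at this
  have a1 : |k (x + w) - k x| < ε / 2 := by
    by_contra! hc
    exact hw' (Or.inl ⟨⟨by linarith [hw.1], hw.2⟩, hc⟩)
  have a2 : |k (x + w) - k (x + u)| < ε / 2 := by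
    by_contra! hc
    refine hw' (Or.inr ⟨⟨by linarith [hw.1, hu.2], by linarith [hw.2, hu.1]⟩, ?_⟩)
    have : x + u + (w + -u) = x + w := by ring
    rw [this]
    exact hc
  rw [abs_lt] at *
  constructor <;> linarith

lemma eventually_increment_le {k : ℝ → ℝ} (hk : Measurable k)
    (h : ∀ u, Tendsto (fun x => k (x + u) - k x) atTop (𝓝 0)) {ε : ℝ} (hε : 0 < ε) :
    ∀ᶠ x in atTop, ∀ u, 0 ≤ u → |k (x + u) - k x| ≤ ε * (u + 1) := by
  obtain ⟨x₀, hx₀⟩ := eventually_atTop.1 (eventually_increment_lt hk h hε)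
  have key : ∀ n : ℕ, ∀ x ≥ x₀, ∀ u : ℝ, 0 ≤ u → u ≤ n + 1 → |k (x + u) - k x| ≤ ε * (u + 1) := by
    intro n
    induction n with
    | zero =>
      intro x hx u hu hu1
      refine (hx₀ x hx u ⟨hu, by simpa using hu1⟩).le.trans ?_
      nlinarith
    | succ n ih =>
      intro x hx u hu hu1
      by_cases h1 : u ≤ 1
      · refine (hx₀ x hx u ⟨hu, h1⟩).le.trans ?_
        nlinarith
      · push Not at h1
        push_cast at hu1
        have i1 := ih (x + 1) (by linarith) (u - 1) (by linarith) (by linarith)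
        have i2 := (hx₀ x hx 1 ⟨by norm_num, le_rfl⟩).le
        have : x + 1 + (u - 1) = x + u := by ring
        rw [this] at i1
        rw [abs_le] at *
        constructor <;> linarith
  filter_upwards [eventually_ge_atTop x₀] with x hx u hu
  exact key ⌈u⌉₊ x hx u hu ((Nat.le_ceil u).trans (by linarith))

lemma tendsto_increment {k : ℝ → ℝ} (hk : Measurable k)
    (h : ∀ u, Tendsto (fun x => k (x + u) - k x) atTop (𝓝 0)) {ι : Type*} {l : Filter ι}
    {x v : ι → ℝ} {v₀ : ℝ} (hx : Tendsto x l atTop) (hv : Tendsto v l (𝓝 v₀)) :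
    Tendsto (fun i => k (x i + v i) - k (x i)) l (𝓝 0) := by
  have h1 : Tendsto (fun i => k (x i + (v₀ - 1 / 2)) - k (x i)) l (𝓝 0) := (h _).comp hx
  have hx' : Tendsto (fun i => x i + (v₀ - 1 / 2)) l atTop := tendsto_atTop_add_const_right _ _ hx
  have h2 : Tendsto (fun i => k (x i + v i) - k (x i + (v₀ - 1 / 2))) l (𝓝 0) := by
    rw [Metric.tendsto_nhds]
    intro ε hε
    filter_upwards [hx'.eventually (eventually_increment_lt hk h hε),
      hv.eventually (Icc_mem_nhds (show v₀ - 1 / 2 < v₀ by linarith)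
        (show v₀ < v₀ + 1 / 2 by linarith))] with i hi hvi
    have := hi (v i - (v₀ - 1 / 2)) ⟨by linarith [hvi.1], by linarith [hvi.2]⟩
    rw [add_add_sub_cancel] at this
    simpa [Real.dist_eq] using this
  have := h2.add h1
  simpa using this

variable {φ : ℝ → ℝ} {α : ℝ}

lemma eventually_pos (h0 : ∀ r, 0 ≤ φ r)
    (hRV : ∀ t, 0 < t → Tendsto (fun r => φ (r * t) / φ r) atTop (𝓝 (t ^ (-α)))) :
    ∀ᶠ r in atTop, 0 < φ r := by
  have := hRV 1 one_pos
  simp only [mul_one, Real.one_rpow] at this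
  filter_upwards [this.eventually_ne one_ne_zero] with r hr
  refine lt_of_le_of_ne (h0 r) fun hc => hr ?_
  rw [← hc, div_zero]

/-- The logarithm of the slowly varying part `r ^ α * φ r` of `φ`, as a function of `x = log r`. -/
noncomputable def logPart (φ : ℝ → ℝ) (α x : ℝ) : ℝ := Real.log (φ (Real.exp x)) + α * x

lemma measurable_logPart (hφ : Measurable φ) : Measurable (logPart φ α) := by
  unfold logPart
  fun_prop

lemma tendsto_logPart (h0 : ∀ r, 0 ≤ φ r)
    (hRV : ∀ t, 0 < t → Tendsto (fun r => φ (r * t) / φ r) atTop (𝓝 (t ^ (-α)))) (u : ℝ) :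
    Tendsto (fun x => logPart φ α (x + u) - logPart φ α x) atTop (𝓝 0) := by
  have h1 := ((hRV (Real.exp u) (Real.exp_pos u)).comp Real.tendsto_exp_atTop).log
    (by positivity)
  have h2 := h1.add_const (α * u)
  rw [Real.log_rpow (Real.exp_pos u), Real.log_exp] at h2
  have e : -α * u + α * u = 0 := by ring
  rw [e] at h2
  have hpos := Real.tendsto_exp_atTop.eventually (eventually_pos h0 hRV)
  have hpos' := (tendsto_atTop_add_const_right _ u tendsto_id).eventually hpos
  refine h2.congr' ?_
  filter_upwards [hpos, hpos'] with x hx hx'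
  simp only [id] at hx'
  simp only [Function.comp, logPart, Real.exp_add] at *
  rw [Real.log_div hx'.ne' hx.ne']
  ring

lemma eq_exp_logPart {r : ℝ} (hr : 0 < r) (h : 0 < φ r) :
    φ r = r ^ (-α) * Real.exp (logPart φ α (Real.log r)) := by
  rw [logPart, Real.exp_log hr, Real.exp_add, Real.exp_log h, mul_comm α,
    ← Real.rpow_def_of_pos hr, mul_left_comm, ← Real.rpow_add hr]
  simp

lemma tendsto_ratio (hφ : Measurable φ) (h0 : ∀ r, 0 ≤ φ r)
    (hRV : ∀ t, 0 < t → Tendsto (fun r => φ (r * t) / φ r) atTop (𝓝 (t ^ (-α))))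
    {ι : Type*} {l : Filter ι} {r s : ι → ℝ} {s₀ : ℝ} (hs₀ : 0 < s₀) (hr : Tendsto r l atTop)
    (hs : Tendsto s l (𝓝 s₀)) :
    Tendsto (fun i => φ (r i * s i) / φ (r i)) l (𝓝 (s₀ ^ (-α))) := by
  have hinc := tendsto_increment (measurable_logPart (α := α) hφ) (tendsto_logPart h0 hRV)
    (Real.tendsto_log_atTop.comp hr) (hs.log hs₀.ne')
  have h1 := (hs.rpow_const (p := -α) (Or.inl hs₀.ne')).mul
    (Real.continuous_exp.tendsto _ |>.comp hinc)
  rw [Real.exp_zero, mul_one] at h1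
  have hrs : Tendsto (fun i => r i * s i) l atTop := hr.atTop_mul_pos hs₀ hs
  refine h1.congr' ?_
  filter_upwards [hr.eventually (eventually_pos h0 hRV), hrs.eventually (eventually_pos h0 hRV),
    hr.eventually_gt_atTop 0, hs.eventually_const_lt hs₀] with i p1 p2 p3 p4
  rw [eq_exp_logPart (α := α) p3 p1, eq_exp_logPart (α := α) (mul_pos p3 p4) p2,
    Real.log_mul p3.ne' p4.ne', Real.mul_rpow p3.le p4.le]
  simp only [Function.comp]
  rw [Real.exp_sub]
  have := (Real.rpow_pos_of_pos p3 (-α)).ne'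
  field_simp

/-- Potter bounds: on the logarithmic scale, increments below `ε` over unit steps add up to at most
`ε * (u + 1)` over a distance `u`. -/
lemma potter (hφ : Measurable φ) (h0 : ∀ r, 0 ≤ φ r)
    (hRV : ∀ t, 0 < t → Tendsto (fun r => φ (r * t) / φ r) atTop (𝓝 (t ^ (-α))))
    {ε : ℝ} (hε : 0 < ε) :
    ∀ᶠ ρ in atTop, ∀ r, ρ ≤ r → φ r ≤ Real.exp ε * (r / ρ) ^ (-(α - ε)) * φ ρ ∧
      Real.exp (-ε) * (r / ρ) ^ (-(α + ε)) * φ ρ ≤ φ r := by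
  obtain ⟨r₀, hr₀⟩ := eventually_atTop.1 (eventually_pos h0 hRV)
  filter_upwards [eventually_ge_atTop r₀, eventually_gt_atTop 0, Real.tendsto_log_atTop.eventually
    (eventually_increment_le (measurable_logPart (α := α) hφ) (tendsto_logPart h0 hRV) hε)]
    with ρ h1 hρ h2 r hr
  have hrp : 0 < r := hρ.trans_le hr
  have hu : 0 ≤ Real.log (r / ρ) := Real.log_nonneg ((one_le_div hρ).2 hr)
  have h3 := h2 _ hu
  have e1 : Real.log ρ + Real.log (r / ρ) = Real.log r := by
    rw [Real.log_div hrp.ne' hρ.ne']; ring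
  rw [e1, abs_le] at h3
  have hdr : 0 < r / ρ := div_pos hrp hρ
  have e2 : r ^ (-α) = ρ ^ (-α) * (r / ρ) ^ (-α) := by
    rw [← Real.mul_rpow hρ.le hdr.le, mul_div_cancel₀ _ hρ.ne']
  have e3 : φ r = φ ρ * (r / ρ) ^ (-α) *
      Real.exp (logPart φ α (Real.log r) - logPart φ α (Real.log ρ)) := by
    rw [eq_exp_logPart (α := α) hrp (hr₀ r (h1.trans hr)),
      eq_exp_logPart (α := α) hρ (hr₀ ρ h1), e2, Real.exp_sub]
    field_simp
  have hp := hr₀ ρ h1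
  have hq := Real.rpow_pos_of_pos hdr (-α)
  constructor
  · calc φ r ≤ φ ρ * (r / ρ) ^ (-α) * Real.exp (ε * (Real.log (r / ρ) + 1)) := by
          rw [e3]
          exact mul_le_mul_of_nonneg_left (Real.exp_le_exp.2 h3.2) (by positivity)
      _ = _ := by
          rw [neg_sub, sub_eq_add_neg, Real.rpow_add hdr, Real.rpow_def_of_pos hdr ε, mul_add,
            Real.exp_add, mul_one, mul_comm ε (Real.log _)]
          ring
  · calc _ = φ ρ * (r / ρ) ^ (-α) * Real.exp (-(ε * (Real.log (r / ρ) + 1))) := by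
          rw [neg_add, Real.rpow_add hdr, Real.rpow_def_of_pos hdr (-ε), mul_add, neg_add,
            Real.exp_add, mul_one, mul_neg, mul_comm ε (Real.log _)]
          ring
      _ ≤ φ r := by
          rw [e3]
          exact mul_le_mul_of_nonneg_left (Real.exp_le_exp.2 h3.1) (by positivity)

end RegVar

namespace GeomComplex

/-! ### Elementary properties of the scaled indicators -/

variable {d : ℕ} {h : Finset (E d) → ℝ}

lemma mem_pointSet {ι : Type*} [Fintype ι] {x : ι → E d} {y : E d} :
    y ∈ pointSet x ↔ ∃ i, x i = y := by
  simp [pointSet]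

lemma pointSet_nonempty {ι : Type*} [Fintype ι] [Nonempty ι] (x : ι → E d) :
    (pointSet x).Nonempty :=
  ⟨x (Classical.arbitrary ι), mem_pointSet.2 ⟨_, rfl⟩⟩

lemma mem_dilate {a : ℝ} {𝒳 : Finset (E d)} {y : E d} :
    y ∈ dilate a 𝒳 ↔ ∃ x ∈ 𝒳, a • x = y := by
  simp [dilate]

lemma mem_translate {z : E d} {𝒳 : Finset (E d)} {y : E d} :
    y ∈ translate 𝒳 z ↔ ∃ x ∈ 𝒳, x + z = y := by
  unfold translate
  exact Finset.mem_image

lemma dilate_nonempty {a : ℝ} {𝒳 : Finset (E d)} (hX : 𝒳.Nonempty) : (dilate a 𝒳).Nonempty := by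
  obtain ⟨x, hx⟩ := hX
  exact ⟨a • x, mem_dilate.2 ⟨x, hx, rfl⟩⟩

lemma pointSet_comp_equiv {ι κ : Type*} [Fintype ι] [Fintype κ] (e : ι ≃ κ) (x : κ → E d) :
    pointSet (fun i => x (e i)) = pointSet x := by
  ext y
  simp only [mem_pointSet]
  exact ⟨fun ⟨i, hi⟩ => ⟨e i, hi⟩, fun ⟨j, hj⟩ => ⟨e.symm j, by simpa using hj⟩⟩

lemma dilate_pointSet {ι : Type*} [Fintype ι] (a : ℝ) (x : ι → E d) :
    dilate a (pointSet x) = pointSet (fun i => a • x i) := by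
  ext y
  simp [mem_dilate, mem_pointSet]

lemma translate_pointSet {ι : Type*} [Fintype ι] (x : ι → E d) (z : E d) :
    translate (pointSet x) z = pointSet (fun i => x i + z) := by
  ext y
  simp [mem_translate, mem_pointSet]

lemma scaled_zero (𝒳 : Finset (E d)) : scaled h 0 𝒳 = if 𝒳.card = 1 then 1 else 0 := by
  simp [scaled]

lemma scaled_of_ne {t : ℝ} (ht : t ≠ 0) (𝒳 : Finset (E d)) :
    scaled h t 𝒳 = h (dilate t⁻¹ 𝒳) := by
  simp [scaled, ht]

lemma insert_zero_pointSet [DecidableEq (E d)] {k : ℕ} (y : Fin k → E d) :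
    insert 0 (pointSet y) = pointSet (Fin.cons 0 y : Fin (k + 1) → E d) := by
  ext z
  simp [mem_pointSet, Fin.exists_fin_succ, eq_comm]

lemma hZero_eq (k : ℕ) (t : ℝ) (y : Fin k → E d) :
    hZero h k t y = scaled h t (pointSet (Fin.cons 0 y : Fin (k + 1) → E d)) := by
  rw [hZero, insert_zero_pointSet]

namespace IsAdmissible

variable (hh : IsAdmissible h)
include hh

lemma scaled_zero_or_one (t : ℝ) {𝒳 : Finset (E d)} (hX : 𝒳.Nonempty) :
    scaled h t 𝒳 = 0 ∨ scaled h t 𝒳 = 1 := by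
  by_cases ht : t = 0
  · subst ht
    rw [scaled_zero]
    split_ifs <;> simp
  · rw [scaled_of_ne ht]
    exact hh.zero_or_one _ (dilate_nonempty hX)

lemma scaled_nonneg (t : ℝ) {𝒳 : Finset (E d)} (hX : 𝒳.Nonempty) : 0 ≤ scaled h t 𝒳 := by
  rcases hh.scaled_zero_or_one t hX with h | h <;> rw [h]
  exact zero_le_one

lemma scaled_le_one (t : ℝ) {𝒳 : Finset (E d)} (hX : 𝒳.Nonempty) : scaled h t 𝒳 ≤ 1 := by
  rcases hh.scaled_zero_or_one t hX with h | h <;> rw [h]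
  exact zero_le_one

lemma scaled_singleton (t : ℝ) (x : E d) : scaled h t {x} = 1 := by
  by_cases ht : t = 0
  · subst ht
    simp [scaled_zero]
  · rw [scaled_of_ne ht]
    have : dilate t⁻¹ {x} = {t⁻¹ • x} := by simp [dilate]
    rw [this, hh.singleton]

lemma scaled_translate (t : ℝ) {𝒳 : Finset (E d)} (hX : 𝒳.Nonempty) (y : E d) :
    scaled h t (translate 𝒳 y) = scaled h t 𝒳 := by
  classical
  by_cases ht : t = 0
  · subst ht
    have : (translate 𝒳 y).card = 𝒳.card := by
      rw [translate, Finset.card_image_of_injective _ (add_left_injective y)]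
    rw [scaled_zero, scaled_zero, this]
  · rw [scaled_of_ne ht, scaled_of_ne ht]
    have : dilate t⁻¹ (translate 𝒳 y) = translate (dilate t⁻¹ 𝒳) (t⁻¹ • y) := by
      ext z
      simp [mem_dilate, mem_translate]
    rw [this, hh.translation _ _ (dilate_nonempty hX)]

lemma scaled_mono_zero {s t : ℝ} (hs : 0 ≤ s) (hst : s ≤ t) {𝒳 : Finset (E d)}
    (hX : 𝒳.Nonempty) : scaled h s 𝒳 ≤ scaled h t 𝒳 := by
  rcases hs.eq_or_lt with rfl | hs
  · by_cases hc : 𝒳.card = 1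
    · obtain ⟨x, rfl⟩ := Finset.card_eq_one.1 hc
      rw [hh.scaled_singleton, hh.scaled_singleton]
    · rw [scaled_zero, if_neg hc]
      exact hh.scaled_nonneg t hX
  · exact hh.scaled_mono s t 𝒳 hs hst hX

lemma exists_dist_le : ∃ c : ℝ, 0 < c ∧ ∀ t : ℝ, 0 ≤ t → ∀ 𝒳 : Finset (E d), 𝒳.Nonempty →
    scaled h t 𝒳 ≠ 0 → ∀ x ∈ 𝒳, ∀ y ∈ 𝒳, dist x y ≤ c * t := by
  obtain ⟨c, hc, hloc⟩ := hh.loc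
  refine ⟨c, hc, fun t ht 𝒳 hX hne x hx y hy => ?_⟩
  rcases ht.eq_or_lt with rfl | ht
  · rw [scaled_zero] at hne
    by_cases h1 : 𝒳.card = 1
    · obtain ⟨z, rfl⟩ := Finset.card_eq_one.1 h1
      rw [Finset.mem_singleton] at hx hy
      simp [hx, hy]
    · simp [h1] at hne
  · rw [scaled_of_ne ht.ne'] at hne
    have h1 : Metric.diam (dilate t⁻¹ 𝒳 : Set (E d)) ≤ c := by
      by_contra! hcon
      exact hne (hloc _ (dilate_nonempty hX) hcon)
    have h2 : dist (t⁻¹ • x) (t⁻¹ • y) ≤ c :=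
      (Metric.dist_le_diam_of_mem (Finset.finite_toSet _).isBounded
        (Finset.mem_coe.2 (mem_dilate.2 ⟨x, hx, rfl⟩))
        (Finset.mem_coe.2 (mem_dilate.2 ⟨y, hy, rfl⟩))).trans h1
    rw [dist_smul₀, norm_inv, Real.norm_of_nonneg ht.le] at h2
    rwa [inv_mul_le_iff₀ ht, mul_comm] at h2

lemma measurable_scaled (t : ℝ) {ι : Type*} [Fintype ι] [Nonempty ι] :
    Measurable (fun x : ι → E d => scaled h t (pointSet x)) := by
  by_cases ht : t = 0
  · subst ht
    have e : ∀ x : ι → E d, (pointSet x).card = 1 ↔ ∀ i j, x i = x j := by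
      intro x
      rw [Finset.card_eq_one]
      constructor
      · rintro ⟨a, ha⟩ i j
        have hi : x i ∈ pointSet x := mem_pointSet.2 ⟨i, rfl⟩
        have hj : x j ∈ pointSet x := mem_pointSet.2 ⟨j, rfl⟩
        rw [ha, Finset.mem_singleton] at hi hj
        rw [hi, hj]
      · intro hx
        refine ⟨x (Classical.arbitrary ι), ?_⟩
        ext y
        rw [mem_pointSet, Finset.mem_singleton]
        exact ⟨fun ⟨i, hi⟩ => by rw [← hi, hx], fun hy => ⟨_, hy.symm⟩⟩
    simp_rw [scaled_zero, e]
    refine Measurable.ite ?_ measurable_const measurable_const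
    simp only [ofPred_forall]
    exact MeasurableSet.iInter fun i => MeasurableSet.iInter fun j =>
      measurableSet_eq_fun (measurable_pi_apply i) (measurable_pi_apply j)
  · simp_rw [scaled_of_ne ht, dilate_pointSet]
    obtain ⟨k, hk⟩ : ∃ k, Fintype.card ι = k + 1 :=
      ⟨Fintype.card ι - 1, by have := Fintype.card_pos (α := ι); omega⟩
    let e : Fin (k + 1) ≃ ι := (Fintype.equivFinOfCardEq hk).symm
    have : ∀ x : ι → E d, h (pointSet fun i => t⁻¹ • x i)
        = h (pointSet fun i : Fin (k + 1) => t⁻¹ • x (e i)) := by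
      intro x
      rw [pointSet_comp_equiv e (fun i => t⁻¹ • x i)]
    simp_rw [this]
    refine (hh.measurable k).comp ?_
    fun_prop

lemma measurable_hZero (k : ℕ) (t : ℝ) : Measurable (hZero h k t) := by
  have e : hZero h k t = (fun x : Fin (k + 1) → E d => scaled h t (pointSet x)) ∘
      (fun y : Fin k → E d => (Fin.cons 0 y : Fin (k + 1) → E d)) := by
    ext y
    exact hZero_eq k t y
  rw [e]
  refine (hh.measurable_scaled t).comp (measurable_pi_iff.2 fun i => ?_)
  refine Fin.cases ?_ (fun j => ?_) i
  · simp
  · simpa using measurable_pi_apply j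

lemma hZero_nonneg (k : ℕ) (t : ℝ) (y : Fin k → E d) : 0 ≤ hZero h k t y := by
  rw [hZero_eq]
  exact hh.scaled_nonneg t (pointSet_nonempty _)

lemma hZero_le_one (k : ℕ) (t : ℝ) (y : Fin k → E d) : hZero h k t y ≤ 1 := by
  rw [hZero_eq]
  exact hh.scaled_le_one t (pointSet_nonempty _)

lemma exists_hZero_le_indicator : ∃ c : ℝ, 0 < c ∧ ∀ t : ℝ, 0 ≤ t → ∀ (k : ℕ) (y : Fin k → E d),
    hZero h k t y ≤ (Set.univ.pi fun _ => Metric.closedBall (0 : E d) (c * t)).indicator 1 y := by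
  obtain ⟨c, hc, hloc⟩ := hh.exists_dist_le
  refine ⟨c, hc, fun t ht k y => ?_⟩
  by_cases hy : y ∈ Set.univ.pi fun _ => Metric.closedBall (0 : E d) (c * t)
  · rw [indicator_of_mem hy]
    exact hh.hZero_le_one k t y
  · rw [indicator_of_notMem hy]
    by_contra! hcon
    refine hy fun i _ => ?_
    rw [hZero_eq] at hcon
    exact hloc t ht _ (pointSet_nonempty _) hcon.ne' _ (mem_pointSet.2 ⟨i.succ, by simp⟩) _
      (mem_pointSet.2 ⟨0, by simp⟩)

lemma integrable_hZero (k : ℕ) {t : ℝ} (ht : 0 ≤ t) : Integrable (hZero h k t) := by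
  obtain ⟨c, hc, hb⟩ := hh.exists_hZero_le_indicator
  have hm : MeasurableSet (Set.univ.pi fun _ : Fin k => Metric.closedBall (0 : E d) (c * t)) :=
    MeasurableSet.univ_pi fun _ => Metric.isClosed_closedBall.measurableSet
  have hi : Integrable ((Set.univ.pi fun _ : Fin k =>
      Metric.closedBall (0 : E d) (c * t)).indicator (1 : (Fin k → E d) → ℝ)) := by
    rw [integrable_indicator_iff hm]
    refine integrableOn_const ?_
    rw [volume_pi_pi]
    exact ENNReal.prod_ne_top fun _ _ => measure_closedBall_lt_top.ne
  refine hi.mono' (hh.measurable_hZero k t).aestronglyMeasurable ?_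
  refine Eventually.of_forall fun y => ?_
  rw [Real.norm_of_nonneg (hh.hZero_nonneg k t y)]
  exact hb t ht k y

lemma exists_integral_hZero_le : ∃ v : ℝ, 0 ≤ v ∧ ∀ k : ℕ, ∫ y, hZero h k 1 y ≤ v ^ k := by
  obtain ⟨c, hc, hb⟩ := hh.exists_hZero_le_indicator
  refine ⟨volume.real (Metric.closedBall (0 : E d) c), measureReal_nonneg, fun k => ?_⟩
  have hm : MeasurableSet (Set.univ.pi fun _ : Fin k => Metric.closedBall (0 : E d) c) :=
    MeasurableSet.univ_pi fun _ => Metric.isClosed_closedBall.measurableSet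
  have hv : volume.real (Set.univ.pi fun _ : Fin k => Metric.closedBall (0 : E d) c)
      = volume.real (Metric.closedBall (0 : E d) c) ^ k := by
    rw [measureReal_def, volume_pi_pi, ENNReal.toReal_prod]
    simp [measureReal_def]
  rw [← hv, ← integral_indicator_one hm]
  refine integral_mono (hh.integrable_hZero k zero_le_one) ?_ fun y => ?_
  · rw [integrable_indicator_iff hm]
    refine integrableOn_const ?_
    rw [volume_pi_pi]
    exact ENNReal.prod_ne_top fun _ _ => measure_closedBall_lt_top.ne
  · simpa using hb 1 zero_le_one k y

lemma integral_hZero (hd : d ≠ 0) (k : ℕ) {t : ℝ} (ht : 0 ≤ t) :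
    ∫ y, hZero h k t y = t ^ (d * k) * ∫ y, hZero h k 1 y := by
  rcases ht.eq_or_lt with rfl | ht
  · cases k with
    | zero =>
      have : ∀ t, hZero h 0 t = fun _ => 1 := by
        intro t
        ext y
        rw [hZero_eq]
        convert hh.scaled_singleton t 0
        ext z
        simp [mem_pointSet, eq_comm]
      simp [this]
    | succ k =>
      have hne : d * (k + 1) ≠ 0 := by positivity
      rw [zero_pow hne, zero_mul]
      obtain ⟨c, hc, hb⟩ := hh.exists_hZero_le_indicator
      refine integral_eq_zero_of_ae ?_
      have : Nontrivial (E d) := by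
        have : Nonempty (Fin d) := ⟨⟨0, Nat.pos_of_ne_zero hd⟩⟩
        infer_instance
      have hnull : volume ({0} : Set (Fin (k + 1) → E d)) = 0 := by
        have : ({0} : Set (Fin (k + 1) → E d)) = Set.univ.pi fun _ => {0} := by
          ext y
          simp [funext_iff, Set.mem_pi]
        rw [this, volume_pi_pi]
        simp
      filter_upwards [compl_mem_ae_iff.2 hnull] with y hy
      refine le_antisymm ?_ (hh.hZero_nonneg _ _ y)
      refine (hb 0 le_rfl _ y).trans ?_
      rw [indicator_of_notMem]
      · simp
      · intro hy'
        refine hy ?_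
        rw [mem_singleton_iff]
        ext1 i
        have := hy' i (mem_univ _)
        simpa using this
  · have e : ∀ y, hZero h k t y = hZero h k 1 (t⁻¹ • y) := by
      intro y
      rw [hZero_eq, hZero_eq, scaled_of_ne ht.ne', scaled_of_ne one_ne_zero, dilate_pointSet,
        dilate_pointSet]
      congr 2
      ext1 i
      refine Fin.cases ?_ (fun j => ?_) i <;> simp
    simp_rw [e]
    rw [Measure.integral_comp_smul]
    simp only [Module.finrank_pi_fintype, finrank_euclideanSpace, Fintype.card_fin,
      Finset.sum_const, Finset.card_univ, smul_eq_mul]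
    rw [inv_pow, inv_inv, abs_of_nonneg (by positivity), mul_comm d k]

end IsAdmissible
end GeomComplex

namespace GeomComplex

/-! ### The limit function and the sample paths -/

variable {d : ℕ} {h : Finset (E d) → ℝ}

lemma sphereArea_nonneg (d : ℕ) : 0 ≤ sphereArea d := by
  unfold sphereArea
  positivity

lemma regVar_exponent_pos {α : ℝ} (hα : (d : ℝ) < α) (k : ℕ) : 0 < α * (k + 1) - d := by
  have : (0 : ℝ) ≤ d := Nat.cast_nonneg d
  have : 0 ≤ α * k := mul_nonneg (by linarith) (Nat.cast_nonneg k)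
  linarith

/-- For `k = 0` the general formula remains correct, as the integral over a one-point space is
`h_t({0}) = 1`. -/
lemma sLim_eq (hh : IsAdmissible h) (α ξ : ℝ) (k : ℕ) (t : ℝ) :
    sLim h α ξ k t = sphereArea d * ξ ^ (k + 1) / ((k + 1).factorial * (α * (k + 1) - d)) *
      ∫ y : Fin k → E d, hZero h k t y := by
  unfold sLim
  split_ifs with hk
  · subst hk
    have : hZero h 0 t = fun _ => 1 := by
      ext y
      rw [hZero_eq]
      convert hh.scaled_singleton t 0
      ext z
      simp [mem_pointSet, eq_comm]
    have hv : (volume : Measure (Fin 0 → E d)).real univ = 1 := by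
      rw [volume_pi, Measure.pi_of_empty]
      simp
    simp [this, hv]
  · rfl

lemma sLim_eq_pow_mul (hh : IsAdmissible h) (hd : d ≠ 0) (α ξ : ℝ) (k : ℕ) {t : ℝ} (ht : 0 ≤ t) :
    sLim h α ξ k t = t ^ (d * k) * sLim h α ξ k 1 := by
  rw [sLim_eq hh, sLim_eq hh, hh.integral_hZero hd k ht]
  ring

lemma sLim_nonneg (hh : IsAdmissible h) {α ξ : ℝ} (hα : (d : ℝ) < α) (hξ : 0 < ξ) (k : ℕ)
    (t : ℝ) : 0 ≤ sLim h α ξ k t := by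
  rw [sLim_eq hh]
  have := regVar_exponent_pos hα k
  have := sphereArea_nonneg d
  have : 0 ≤ ∫ y : Fin k → E d, hZero h k t y := integral_nonneg fun y => hh.hZero_nonneg k t y
  positivity

/-- The coefficients `s_k` decay factorially, locally uniformly in `t`. -/
lemma exists_sLim_le (hh : IsAdmissible h) (hd : d ≠ 0) {α ξ : ℝ} (hα : (d : ℝ) < α)
    (hξ : 0 < ξ) (T : ℝ) :
    ∃ u : ℕ → ℝ, Summable u ∧ ∀ k, ∀ t ∈ Icc 0 T, sLim h α ξ k t ≤ u k := by
  obtain ⟨v, hv, hvk⟩ := hh.exists_integral_hZero_le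
  refine ⟨fun k => sphereArea d * ξ / (α - d) * ((T ^ d * ξ * v) ^ k / k.factorial),
    (Real.summable_pow_div_factorial _).mul_left _, fun k t ht => ?_⟩
  have hT : 0 ≤ T := ht.1.trans ht.2
  rw [sLim_eq_pow_mul hh hd _ _ _ ht.1, sLim_eq hh]
  have h1 := regVar_exponent_pos hα k
  have h2 := sphereArea_nonneg d
  have h3 : 0 ≤ ∫ y : Fin k → E d, hZero h k 1 y := integral_nonneg fun y => hh.hZero_nonneg k 1 y
  have h4 : 0 < α - d := sub_pos.2 hα
  have h5 : α - d ≤ α * (k + 1) - d := by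
    have : (0 : ℝ) ≤ α * k := mul_nonneg ((Nat.cast_nonneg d).trans hα.le) (Nat.cast_nonneg k)
    linarith
  have h6 : (k.factorial : ℝ) ≤ (k + 1).factorial := by
    exact_mod_cast Nat.factorial_le (Nat.le_succ k)
  have h7 : (0 : ℝ) < k.factorial := by positivity
  calc t ^ (d * k) * (sphereArea d * ξ ^ (k + 1) / ((k + 1).factorial * (α * (k + 1) - d)) *
      ∫ y : Fin k → E d, hZero h k 1 y)
      ≤ T ^ (d * k) * (sphereArea d * ξ ^ (k + 1) / (k.factorial * (α - d)) * v ^ k) := by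
        gcongr
        · exact ht.1
        · exact ht.2
        · exact hvk k
    _ = _ := by
        simp only [mul_pow, ← pow_mul]
        field_simp
        ring

lemma summable_sLim (hh : IsAdmissible h) (hd : d ≠ 0) {α ξ : ℝ} (hα : (d : ℝ) < α)
    (hξ : 0 < ξ) {t : ℝ} (ht : 0 ≤ t) : Summable fun k => sLim h α ξ k t := by
  obtain ⟨u, hu, hb⟩ := exists_sLim_le hh hd hα hξ t
  exact Summable.of_nonneg_of_le (fun k => sLim_nonneg hh hα hξ k t)
    (fun k => hb k t ⟨ht, le_rfl⟩) hu

lemma summable_alternating_sLim (hh : IsAdmissible h) (hd : d ≠ 0) {α ξ : ℝ} (hα : (d : ℝ) < α)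
    (hξ : 0 < ξ) {t : ℝ} (ht : 0 ≤ t) : Summable fun k => (-1 : ℝ) ^ k * sLim h α ξ k t := by
  refine Summable.of_norm ?_
  simpa [abs_of_nonneg (sLim_nonneg hh hα hξ _ t)] using summable_sLim hh hd hα hξ ht

lemma continuousOn_sLim (hh : IsAdmissible h) (hd : d ≠ 0) (α ξ : ℝ) (k : ℕ) :
    ContinuousOn (sLim h α ξ k) (Ici 0) := by
  have : ContinuousOn (fun t : ℝ => t ^ (d * k) * sLim h α ξ k 1) (Ici 0) := by fun_prop
  exact this.congr fun t ht => sLim_eq_pow_mul hh hd α ξ k ht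

lemma continuousOn_limitFun (hh : IsAdmissible h) (hd : d ≠ 0) {α ξ : ℝ} (hα : (d : ℝ) < α)
    (hξ : 0 < ξ) : ContinuousOn (limitFun h α ξ) (Ici 0) := by
  intro t ht
  obtain ⟨u, hu, hb⟩ := exists_sLim_le hh hd hα hξ (t + 1)
  have hc : ContinuousOn (limitFun h α ξ) (Icc 0 (t + 1)) := by
    refine continuousOn_tsum (fun k => ?_) hu fun k s hs => ?_
    · exact ((continuousOn_sLim hh hd α ξ k).mono Icc_subset_Ici_self).const_mul _
    · simpa [abs_of_nonneg (sLim_nonneg hh hα hξ _ s)] using hb k s hs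
  have ht' : t ∈ Icc 0 (t + 1) := ⟨ht, by linarith⟩
  refine (hc t ht').mono_of_mem_nhdsWithin ?_
  rw [← Ici_inter_Iic]
  exact inter_mem_nhdsWithin _ (Iic_mem_nhds (by linarith))

lemma isCadlag_limitFun (hh : IsAdmissible h) (hd : d ≠ 0) {α ξ : ℝ} (hα : (d : ℝ) < α)
    (hξ : 0 < ξ) : IsCadlag (limitFun h α ξ) := by
  have hc := continuousOn_limitFun hh hd hα hξ
  refine ⟨fun t ht => (hc t ht).mono (Ici_subset_Ici.2 ht), fun t ht => ⟨limitFun h α ξ t, ?_⟩⟩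
  exact ((hc t ht.le).continuousAt (Ici_mem_nhds ht)).tendsto.mono_left nhdsWithin_le_nhds

lemma IsCadlag.const_mul {x : ℝ → ℝ} (hx : IsCadlag x) (c : ℝ) : IsCadlag fun t => c * x t :=
  ⟨fun t ht => (hx.1 t ht).const_mul c, fun t ht => by
    obtain ⟨l, hl⟩ := hx.2 t ht
    exact ⟨c * l, hl.const_mul c⟩⟩

lemma IsCadlag.sum {ι : Type*} {s : Finset ι} {x : ι → ℝ → ℝ} (hx : ∀ i ∈ s, IsCadlag (x i)) :
    IsCadlag fun t => ∑ i ∈ s, x i t := by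
  refine ⟨fun t ht => ?_, fun t ht => ?_⟩
  · exact tendsto_finsetSum _ fun i hi => (hx i hi).1 t ht
  · choose! l hl using fun i hi => (hx i hi).2 t ht
    exact ⟨∑ i ∈ s, l i, tendsto_finsetSum _ fun i hi => hl i hi⟩

lemma isCadlag_scaled (hh : IsAdmissible h) {𝒳 : Finset (E d)} (hX : 𝒳.Nonempty)
    (hc : ∀ t : ℝ, 0 < t → ContinuousWithinAt (fun s => scaled h s 𝒳) (Ici t) t) :
    IsCadlag fun t => scaled h t 𝒳 := by
  have hmono : MonotoneOn (fun t => scaled h t 𝒳) (Ici 0) := fun s hs t _ hst =>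
    hh.scaled_mono_zero hs hst hX
  refine ⟨fun t ht => ?_, fun t ht => ?_⟩
  · rcases ht.eq_or_lt with rfl | ht
    · by_cases h1 : 𝒳.card = 1
      · obtain ⟨x, rfl⟩ := Finset.card_eq_one.1 h1
        simp_rw [hh.scaled_singleton]
        exact continuousWithinAt_const
      · have hnt : 1 < 𝒳.card := by
          have := hX.card_pos
          omega
        obtain ⟨a, ha, b, hb, hab⟩ := Finset.one_lt_card.1 hnt
        obtain ⟨c, hc0, hloc⟩ := hh.exists_dist_le
        have hev : ∀ᶠ t in 𝓝[Ici 0] (0 : ℝ), scaled h t 𝒳 = 0 := by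
          have hlt : (0 : ℝ) < dist a b / c := div_pos (dist_pos.2 hab) hc0
          filter_upwards [self_mem_nhdsWithin, mem_nhdsWithin_of_mem_nhds (Iio_mem_nhds hlt)]
            with t ht htlt
          by_contra hne
          have := hloc t ht 𝒳 hX hne a ha b hb
          rw [mem_Iio, lt_div_iff₀ hc0] at htlt
          linarith
        have h00 : scaled h 0 𝒳 = 0 := by rw [scaled_zero, if_neg h1]
        rw [ContinuousWithinAt, h00]
        exact tendsto_const_nhds.congr' (hev.mono fun t ht => ht.symm)
    · exact hc t ht
  · refine ⟨sSup ((fun t => scaled h t 𝒳) '' Ioo 0 t), ?_⟩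
    refine MonotoneOn.tendsto_nhdsWithin_Ioo_left (nonempty_Ioo.2 ht)
      (hmono.mono fun s hs => hs.1.le) ⟨1, ?_⟩
    rintro _ ⟨s, _, rfl⟩
    exact hh.scaled_le_one s hX

lemma card_sample_le {Ω : Type*} (X : ℕ → Ω → E d) (n : ℕ) (ω : Ω) : (sample X n ω).card ≤ n := by
  classical
  unfold sample pointSet
  exact Finset.card_image_le.trans (by simp)

lemma simplexCount_eq_zero {Ω : Type*} (X : ℕ → Ω → E d) (R : ℝ) {k n : ℕ} (hk : n ≤ k) (t : ℝ)
    (ω : Ω) : simplexCount h X R k n t ω = 0 := by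
  unfold simplexCount
  rw [Finset.powersetCard_eq_empty.2 ((card_sample_le X n ω).trans_lt (by omega)), Finset.sum_empty]

lemma eulerChar_eq_sum {Ω : Type*} (X : ℕ → Ω → E d) (R : ℕ → ℝ) (n : ℕ) (t : ℝ) (ω : Ω) :
    eulerChar h X R n t ω =
      ∑ k ∈ Finset.range n, (-1 : ℝ) ^ k * simplexCount h X (R n) k n t ω := by
  unfold eulerChar
  refine tsum_eq_sum fun k hk => ?_
  rw [simplexCount_eq_zero X (R n) (by simpa using hk), mul_zero]

lemma isCadlag_eulerChar (hh : IsAdmissible h) {Ω : Type*} (X : ℕ → Ω → E d) (R : ℕ → ℝ)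
    (hc : ∀ 𝒳 : Finset (E d), 𝒳.Nonempty → ∀ t : ℝ, 0 < t →
        ContinuousWithinAt (fun s => scaled h s 𝒳) (Ici t) t) (n : ℕ) (ω : Ω) :
    IsCadlag (fun t => eulerChar h X R n t ω) := by
  simp_rw [eulerChar_eq_sum]
  refine IsCadlag.sum fun k _ => IsCadlag.const_mul ?_ _
  unfold simplexCount
  refine IsCadlag.sum fun 𝒴 h𝒴 => ?_
  have hne : 𝒴.Nonempty := by
    rw [← Finset.card_pos, (Finset.mem_powersetCard.1 h𝒴).2]
    omega
  simp_rw [mul_comm (scaled h _ 𝒴)]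
  exact (isCadlag_scaled hh hne (hc 𝒴 hne)).const_mul _

end GeomComplex

namespace GeomComplex

/-! ### Asymptotics of the expected number of simplices spanned by given sample points -/

variable {d : ℕ} {h : Finset (E d) → ℝ}

/-- The `(k+1)`-tuple with first entry `ρ • z` and differences `y` to the other entries. -/
noncomputable def anchoredTuple {k : ℕ} (ρ : ℝ) (p : E d × (Fin k → E d)) : Fin (k + 1) → E d :=
  Fin.cons (ρ • p.1) fun i => p.2 i + ρ • p.1

lemma measurable_anchoredTuple {k : ℕ} (ρ : ℝ) :
    Measurable (anchoredTuple (d := d) (k := k) ρ) := by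
  refine measurable_pi_iff.2 fun i => ?_
  refine Fin.cases ?_ (fun j => ?_) i
  · simp only [anchoredTuple, Fin.cons_zero]
    fun_prop
  · simp only [anchoredTuple, Fin.cons_succ]
    fun_prop

lemma integral_anchoredTuple {k : ℕ} {G : (Fin (k + 1) → E d) → ℝ} (hG : Measurable G) {ρ : ℝ}
    (hρ : 0 < ρ) : ∫ x, G x = ρ ^ d * ∫ p : E d × (Fin k → E d), G (anchoredTuple ρ p) := by
  set c : ENNReal := ENNReal.ofReal (abs (ρ ^ d)⁻¹) with hc
  have h1 : MeasurePreserving (fun z : E d => ρ • z) volume (c • volume) := by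
    refine ⟨by fun_prop, ?_⟩
    rw [Measure.map_addHaar_smul _ hρ.ne', finrank_euclideanSpace, Fintype.card_fin]
  have h2 : MeasurePreserving
      (fun p : E d × (Fin k → E d) => (ρ • p.1, (p.2 + fun _ => ρ • p.1)))
      (volume.prod volume) ((c • volume).prod volume) := by
    refine h1.skew_product (g := fun z y => y + fun _ => ρ • z) ?_ ?_
    · refine measurable_pi_iff.2 fun i => ?_
      simp only [Function.uncurry, Pi.add_apply]
      fun_prop
    · exact Eventually.of_forall fun z => map_add_right_eq_self _ _
  have h3 := (volume_preserving_piFinSuccAbove (fun _ : Fin (k + 1) => E d) 0).symm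
  have hG' : Measurable fun p : E d × (Fin k → E d) =>
      G ((MeasurableEquiv.piFinSuccAbove (fun _ : Fin (k + 1) => E d) 0).symm p) :=
    hG.comp (MeasurableEquiv.measurable _)
  have e1 : ∫ x, G x = ∫ p : E d × (Fin k → E d),
      G ((MeasurableEquiv.piFinSuccAbove (fun _ : Fin (k + 1) => E d) 0).symm p) :=
    (h3.integral_comp' G).symm
  have e2 := integral_map (μ := (volume : Measure (E d)).prod (volume : Measure (Fin k → E d)))
    h2.measurable.aemeasurable (hG'.aestronglyMeasurable
      (μ := ((volume : Measure (E d)).prod volume).map _))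
  rw [h2.map_eq, Measure.prod_smul_left, integral_smul_measure] at e2
  have e3 : ∀ p : E d × (Fin k → E d),
      (MeasurableEquiv.piFinSuccAbove (fun _ : Fin (k + 1) => E d) 0).symm
        (ρ • p.1, (p.2 + fun _ => ρ • p.1)) = anchoredTuple ρ p := by
    intro p
    simp only [MeasurableEquiv.piFinSuccAbove_symm_apply, anchoredTuple]
    exact Fin.insertNth_zero' (β := E d) (ρ • p.1) (p.2 + fun _ => ρ • p.1)
  simp_rw [e3] at e2
  rw [e1, Measure.volume_eq_prod, ← e2, hc,
    ENNReal.toReal_ofReal (abs_nonneg _), abs_of_nonneg (by positivity), smul_eq_mul, ← mul_assoc,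
    mul_inv_cancel₀ (by positivity), one_mul]

/-- The restriction of `f` to the complement of the open ball of radius `ρ`. -/
noncomputable def outerPart (f : E d → ℝ) (ρ : ℝ) (x : E d) : ℝ := if ρ ≤ ‖x‖ then f x else 0

lemma outerPart_nonneg {f : E d → ℝ} (hf : ∀ x, 0 ≤ f x) (ρ : ℝ) (x : E d) :
    0 ≤ outerPart f ρ x := by
  unfold outerPart
  split_ifs
  exacts [hf x, le_rfl]

lemma measurable_outerPart {f : E d → ℝ} (hf : Measurable f) (ρ : ℝ) :
    Measurable (outerPart f ρ) :=
  Measurable.ite (measurableSet_le measurable_const measurable_norm) hf measurable_const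

/-- The limiting radial profile of the rescaled density outside the ball of radius `ρ`. -/
noncomputable def powerTail (γ r : ℝ) : ℝ := (Ioi (1 : ℝ)).indicator (fun r => r ^ (-γ)) r

lemma rpow_smul_powerTail {γ : ℝ} (hd : d ≠ 0) : EqOn
    (fun r : ℝ => r ^ (d - 1) • powerTail γ r)
    ((Ioi (1 : ℝ)).indicator fun r => r ^ ((d : ℝ) - 1 - γ)) (Ioi 0) := by
  intro r hr
  unfold powerTail
  by_cases h1 : r ∈ Ioi (1 : ℝ)
  · simp only [indicator_of_mem h1, smul_eq_mul]
    rw [sub_eq_add_neg _ γ, Real.rpow_add hr, ← Real.rpow_natCast,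
      Nat.cast_sub (Nat.one_le_iff_ne_zero.2 hd), Nat.cast_one]
  · simp only [indicator_of_notMem h1, smul_zero]

lemma Ioi_inter_Ioi_one : Ioi (0 : ℝ) ∩ Ioi 1 = Ioi 1 :=
  inter_eq_self_of_subset_right (Ioi_subset_Ioi zero_le_one)

lemma integrable_powerTail {γ : ℝ} (hd : d ≠ 0) (hγ : (d : ℝ) < γ) :
    Integrable fun z : E d => powerTail γ ‖z‖ := by
  have : Nonempty (Fin d) := ⟨⟨0, Nat.pos_of_ne_zero hd⟩⟩
  rw [integrable_fun_norm_addHaar, finrank_euclideanSpace, Fintype.card_fin,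
    integrableOn_congr_fun (rpow_smul_powerTail hd) measurableSet_Ioi, IntegrableOn,
    integrable_indicator_iff measurableSet_Ioi, IntegrableOn,
    Measure.restrict_restrict measurableSet_Ioi, inter_comm, Ioi_inter_Ioi_one]
  exact integrableOn_Ioi_rpow_of_lt (by linarith) one_pos

lemma integral_powerTail {γ : ℝ} (hd : d ≠ 0) (hγ : (d : ℝ) < γ) :
    ∫ z : E d, powerTail γ ‖z‖ = sphereArea d / (γ - d) := by
  have : Nonempty (Fin d) := ⟨⟨0, Nat.pos_of_ne_zero hd⟩⟩
  rw [integral_fun_norm_addHaar, finrank_euclideanSpace, Fintype.card_fin,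
    setIntegral_congr_fun measurableSet_Ioi (rpow_smul_powerTail hd),
    setIntegral_indicator measurableSet_Ioi, Ioi_inter_Ioi_one,
    integral_Ioi_rpow_of_lt (by linarith) one_pos, Real.one_rpow, sphereArea, nsmul_eq_mul,
    smul_eq_mul, show (d : ℝ) - 1 - γ + 1 = -(γ - d) by ring, neg_div_neg_eq]
  ring

lemma powerTail_pow (γ r : ℝ) (k : ℕ) :
    powerTail γ r ^ (k + 1) = powerTail (γ * (k + 1)) r := by
  unfold powerTail
  by_cases h1 : r ∈ Ioi (1 : ℝ)
  · rw [indicator_of_mem h1, indicator_of_mem h1, ← Real.rpow_natCast,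
      ← Real.rpow_mul (zero_le_one.trans (le_of_lt h1))]
    push_cast
    ring_nf
  · rw [indicator_of_notMem h1, indicator_of_notMem h1, zero_pow (Nat.succ_ne_zero k)]

/-- A density `f` with radial profile `φ` whose tail varies regularly with exponent `-α`. -/
structure HasRegVarProfile (f : E d → ℝ) (φ : ℝ → ℝ) (α : ℝ) : Prop where
  eq_profile : ∀ x, f x = φ ‖x‖
  measurable : Measurable φ
  nonneg : ∀ r, 0 ≤ φ r
  regVar : ∀ t, 0 < t → Tendsto (fun r => φ (r * t) / φ r) atTop (𝓝 (t ^ (-α)))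

namespace HasRegVarProfile

variable {f : E d → ℝ} {φ : ℝ → ℝ} {α : ℝ} (hf : HasRegVarProfile f φ α)
include hf

lemma measurable_density : Measurable f := by
  have : f = fun x => φ ‖x‖ := funext hf.eq_profile
  rw [this]
  exact hf.measurable.comp measurable_norm

lemma density_nonneg (x : E d) : 0 ≤ f x := by
  rw [hf.eq_profile]
  exact hf.nonneg _

lemma eventually_pos : ∀ᶠ ρ in atTop, 0 < φ ρ := RegVar.eventually_pos hf.nonneg hf.regVar

/-- Domination of the rescaled density by an integrable power. -/
lemma exists_outerPart_le {β : ℝ} (hβ0 : 0 ≤ β) (hβ : β < α) : ∃ C : ℝ, 1 ≤ C ∧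
    ∀ᶠ ρ in atTop, ∀ x : E d,
      outerPart f ρ x ≤ C * (‖x‖ / ρ) ^ (-β) * φ ρ ∧ outerPart f ρ x ≤ C * φ ρ := by
  refine ⟨Real.exp (α - β), Real.one_le_exp (by linarith), ?_⟩
  filter_upwards [RegVar.potter hf.measurable hf.nonneg hf.regVar (sub_pos.2 hβ),
    eventually_gt_atTop 0] with ρ hρ hρ0 x
  unfold outerPart
  have := hf.nonneg ρ
  split_ifs with hx
  · rw [hf.eq_profile]
    have h1 : φ ‖x‖ ≤ Real.exp (α - β) * (‖x‖ / ρ) ^ (-β) * φ ρ := by simpa using (hρ _ hx).1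
    refine ⟨h1, h1.trans ?_⟩
    have h2 : (‖x‖ / ρ) ^ (-β) ≤ 1 :=
      Real.rpow_le_one_of_one_le_of_nonpos ((one_le_div hρ0).2 hx) (by linarith)
    have : Real.exp (α - β) * (‖x‖ / ρ) ^ (-β) ≤ Real.exp (α - β) * 1 := by gcongr
    gcongr
    linarith
  · constructor <;> positivity

/-- The profile decays no faster than any power of exponent larger than `α`. -/
lemma exists_le_profile {β : ℝ} (hβ : α < β) :
    ∃ c : ℝ, 0 < c ∧ ∀ᶠ r in atTop, c * r ^ (-β) ≤ φ r := by
  obtain ⟨ρ, h1, h2, h3⟩ := ((RegVar.potter hf.measurable hf.nonneg hf.regVar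
    (sub_pos.2 hβ)).and (hf.eventually_pos.and (eventually_gt_atTop 0))).exists
  refine ⟨Real.exp (-(β - α)) * ρ ^ β * φ ρ, by positivity, ?_⟩
  filter_upwards [eventually_ge_atTop ρ] with r hr
  have := (h1 r hr).2
  rw [add_sub_cancel, Real.div_rpow (h3.le.trans hr) h3.le, Real.rpow_neg h3.le, div_inv_eq_mul]
    at this
  calc _ = Real.exp (-(β - α)) * (r ^ (-β) * ρ ^ β) * φ ρ := by ring
    _ ≤ φ r := this

lemma tendsto_outerPart_div (z y : E d) (hz : ‖z‖ ≠ 1) :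
    Tendsto (fun ρ : ℝ => outerPart f ρ (y + ρ • z) / φ ρ) atTop (𝓝 (powerTail α ‖z‖)) := by
  have hs : Tendsto (fun ρ : ℝ => ‖ρ⁻¹ • y + z‖) atTop (𝓝 ‖z‖) := by
    have : Tendsto (fun ρ : ℝ => ρ⁻¹ • y + z) atTop (𝓝 ((0 : ℝ) • y + z)) :=
      (tendsto_inv_atTop_zero.smul_const y).add_const z
    rw [zero_smul, zero_add] at this
    exact this.norm
  have hn : ∀ᶠ ρ : ℝ in atTop, ‖y + ρ • z‖ = ρ * ‖ρ⁻¹ • y + z‖ := by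
    filter_upwards [eventually_gt_atTop 0] with ρ hρ
    rw [← Real.norm_of_nonneg hρ.le, ← norm_smul, Real.norm_of_nonneg hρ.le, smul_add,
      smul_inv_smul₀ hρ.ne']
  unfold powerTail
  rcases lt_or_gt_of_ne hz with hz | hz
  · rw [indicator_of_notMem (show ‖z‖ ∉ Ioi (1 : ℝ) from not_lt.2 hz.le)]
    refine tendsto_const_nhds.congr' ?_
    filter_upwards [hn, hs.eventually_lt_const hz, eventually_gt_atTop 0] with ρ h1 h2 h3
    rw [outerPart, h1, if_neg, zero_div]
    nlinarith
  · rw [indicator_of_mem (show ‖z‖ ∈ Ioi (1 : ℝ) from hz)]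
    refine (RegVar.tendsto_ratio hf.measurable hf.nonneg hf.regVar (zero_lt_one.trans hz)
      tendsto_id hs).congr' ?_
    filter_upwards [hn, hs.eventually_const_lt hz, eventually_gt_atTop 0] with ρ h1 h2 h3
    rw [outerPart, h1, if_pos (by nlinarith), hf.eq_profile, h1, id]

end HasRegVarProfile

lemma scaled_anchoredTuple (hh : IsAdmissible h) {k : ℕ} (t ρ : ℝ) (p : E d × (Fin k → E d)) :
    scaled h t (pointSet (anchoredTuple ρ p)) = hZero h k t p.2 := by
  rw [hZero_eq, ← hh.scaled_translate t (pointSet_nonempty (Fin.cons 0 p.2 : Fin (k + 1) → E d))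
    (ρ • p.1), translate_pointSet]
  congr 2
  ext1 i
  refine Fin.cases ?_ (fun j => ?_) i <;> simp [anchoredTuple]

/-- For a probability density `f`, the probability that `k + 1` independent points with this density
lie outside the open ball of radius `ρ` and form a simplex of parameter `t`. -/
noncomputable def simplexIntegral (h : Finset (E d) → ℝ) (f : E d → ℝ) (k : ℕ) (t ρ : ℝ) : ℝ :=
  ∫ x : Fin (k + 1) → E d, scaled h t (pointSet x) * ∏ i, outerPart f ρ (x i)

/-- After rescaling the position of one vertex by `ρ`, the other vertices, being within bounded
distance of it, are seen at the same position, so that the normalised density factorises in the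
limit. -/
lemma tendsto_simplexIntegral (hh : IsAdmissible h) (hd : d ≠ 0) {f : E d → ℝ} {φ : ℝ → ℝ} {α : ℝ}
    (hf : HasRegVarProfile f φ α) (hα : (d : ℝ) < α) (k : ℕ) {t : ℝ} (ht : 0 ≤ t) :
    Tendsto (fun ρ => simplexIntegral h f k t ρ / (ρ ^ d * φ ρ ^ (k + 1))) atTop
      (𝓝 (sphereArea d / (α * (k + 1) - d) * ∫ y, hZero h k t y)) := by
  set F : ℝ → E d × (Fin k → E d) → ℝ := fun ρ p =>
    hZero h k t p.2 * ∏ i, (outerPart f ρ (anchoredTuple ρ p i) / φ ρ) with hF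
  have hd0 : (0 : ℝ) ≤ d := Nat.cast_nonneg d
  have key : Tendsto (fun ρ => ∫ p, F ρ p) atTop
      (𝓝 (∫ p : E d × (Fin k → E d), powerTail (α * (k + 1)) ‖p.1‖ * hZero h k t p.2)) := by
    obtain ⟨C, hC, hdom⟩ := hf.exists_outerPart_le (β := (d + α) / 2) (by linarith) (by linarith)
    have hae : ∀ᵐ p : E d × (Fin k → E d), ‖p.1‖ ≠ 1 := by
      have h0 : ∀ᵐ z : E d, ‖z‖ ≠ 1 := by
        have h1 := Measure.addHaar_sphere_of_ne_zero (volume : Measure (E d)) 0 one_ne_zero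
        filter_upwards [compl_mem_ae_iff.2 h1] with z hz
        simpa using hz
      exact Measure.quasiMeasurePreserving_fst.ae h0
    refine tendsto_integral_filter_of_dominated_convergence
      (fun p => C ^ (k + 1) * (powerTail ((d + α) / 2) ‖p.1‖ * hZero h k t p.2)) ?_ ?_ ?_ ?_
    · refine Eventually.of_forall fun ρ => Measurable.aestronglyMeasurable ?_
      refine ((hh.measurable_hZero k t).comp measurable_snd).mul
        (Finset.measurable_prod _ fun i _ => ?_)
      exact ((measurable_outerPart hf.measurable_density ρ).comp
        ((measurable_pi_apply i).comp (measurable_anchoredTuple ρ))).div_const _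
    · filter_upwards [hdom, hf.eventually_pos, eventually_gt_atTop 0] with ρ h1 h2 h3
      filter_upwards [hae] with p hp
      have hnn : ∀ x, 0 ≤ outerPart f ρ x / φ ρ := fun x =>
        div_nonneg (outerPart_nonneg hf.density_nonneg ρ x) h2.le
      have hz := hh.hZero_nonneg k t p.2
      rw [hF, Real.norm_of_nonneg (mul_nonneg hz (Finset.prod_nonneg fun i _ => hnn _)),
        Fin.prod_univ_succ, ← mul_assoc, mul_comm (hZero h k t p.2)]
      have b1 : outerPart f ρ (anchoredTuple ρ p 0) / φ ρ ≤ C * powerTail ((d + α) / 2) ‖p.1‖ := by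
        unfold powerTail
        rw [div_le_iff₀ h2]
        by_cases hp1 : ‖p.1‖ ∈ Ioi (1 : ℝ)
        · rw [indicator_of_mem hp1]
          have e0 : ‖anchoredTuple ρ p 0‖ / ρ = ‖p.1‖ := by
            rw [show anchoredTuple ρ p 0 = ρ • p.1 from rfl, norm_smul, Real.norm_of_nonneg h3.le,
              mul_div_cancel_left₀ _ h3.ne']
          have h4 := (h1 (anchoredTuple ρ p 0)).1
          rwa [e0] at h4
        · rw [indicator_of_notMem hp1, mul_zero, zero_mul]
          have hlt : ‖p.1‖ < 1 := lt_of_le_of_ne (not_lt.1 hp1) hp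
          have e0 : anchoredTuple ρ p 0 = ρ • p.1 := rfl
          rw [outerPart, e0, norm_smul, Real.norm_of_nonneg h3.le, if_neg]
          nlinarith
      have b2 : ∏ i : Fin k, (outerPart f ρ (anchoredTuple ρ p i.succ) / φ ρ) ≤ C ^ k := by
        have : C ^ k = ∏ _i : Fin k, C := by simp
        rw [this]
        exact Finset.prod_le_prod (fun i _ => hnn _) fun i _ => (div_le_iff₀ h2).2 (h1 _).2
      calc _ ≤ C * powerTail ((d + α) / 2) ‖p.1‖ * hZero h k t p.2 * C ^ k :=
            mul_le_mul (mul_le_mul_of_nonneg_right b1 hz) b2 (Finset.prod_nonneg fun i _ => hnn _)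
              (mul_nonneg ((hnn _).trans b1) hz)
        _ = _ := by ring
    · exact ((integrable_powerTail hd (by linarith)).mul_prod
        (hh.integrable_hZero k ht)).const_mul _
    · filter_upwards [hae] with p hp
      rw [← powerTail_pow, mul_comm]
      refine Tendsto.const_mul _ ?_
      have : powerTail α ‖p.1‖ ^ (k + 1) = ∏ _i : Fin (k + 1), powerTail α ‖p.1‖ := by simp
      rw [this]
      refine tendsto_finsetProd _ fun i _ => ?_
      refine Fin.cases ?_ (fun j => ?_) i
      · simpa [anchoredTuple] using hf.tendsto_outerPart_div p.1 0 hp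
      · simpa [anchoredTuple] using hf.tendsto_outerPart_div p.1 (p.2 j) hp
  have hγ : (d : ℝ) < α * (k + 1) := sub_pos.1 (regVar_exponent_pos hα k)
  rw [Measure.volume_eq_prod, integral_prod_mul (fun z : E d => powerTail (α * (k + 1)) ‖z‖),
    integral_powerTail hd hγ] at key
  refine key.congr' ?_
  filter_upwards [hf.eventually_pos, eventually_gt_atTop 0] with ρ h1 h2
  rw [simplexIntegral, integral_anchoredTuple _ h2]
  · rw [mul_div_mul_left _ _ (by positivity), ← integral_div, Measure.volume_eq_prod]
    refine integral_congr_ae (Eventually.of_forall fun p => ?_)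
    simp only [hF]
    rw [scaled_anchoredTuple hh, Finset.prod_div_distrib, mul_div_assoc]
    simp
  · exact (hh.measurable_scaled t).mul (Finset.measurable_prod _ fun i _ =>
      (measurable_outerPart hf.measurable_density ρ).comp (measurable_pi_apply i))

end GeomComplex

namespace GeomComplex

/-! ### Counting simplices by index sets -/

variable {d : ℕ} {h : Finset (E d) → ℝ}

open Classical in
/-- The indicator that the points of the configuration `x` with indices in `I` lie outside the open
ball of radius `ρ` and form a simplex of parameter `t`. -/
noncomputable def faceInd (h : Finset (E d) → ℝ) (t ρ : ℝ) (x : ℕ → E d) (I : Finset ℕ) : ℝ :=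
  scaled h t (pointSet fun i : I => x i) * if ∀ i ∈ I, ρ ≤ ‖x i‖ then 1 else 0

/-- The number of simplices outside the ball of radius `ρ` with index set in the family `𝓕`. -/
noncomputable def faceCount (h : Finset (E d) → ℝ) (t ρ : ℝ) (𝓕 : Finset (Finset ℕ))
    (x : ℕ → E d) : ℝ :=
  ∑ I ∈ 𝓕, faceInd h t ρ x I

open Classical in
/-- The indicator that `y` lies outside the open ball of radius `ρ` and within distance `b` of
`z`. -/
noncomputable def nearInd (ρ b : ℝ) (z y : E d) : ℝ := if ρ ≤ ‖y‖ ∧ dist y z ≤ b then 1 else 0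

/-- The sum of `4 ^ D_i` over the indices `i < n` of points outside the open ball of radius `ρ`,
where `D_i` is the number of other such points within distance `b` of the `i`-th one, written as a
product by means of `4 ^ a = 1 + 3 * a` for `a = 0, 1`. -/
noncomputable def degreeWeight (ρ b : ℝ) (n : ℕ) (x : ℕ → E d) : ℝ :=
  ∑ i ∈ Finset.range n, (if ρ ≤ ‖x i‖ then 1 else 0) *
    ∏ j ∈ (Finset.range n).erase i, (1 + 3 * nearInd ρ b (x i) (x j))

lemma nearInd_nonneg (ρ b : ℝ) (z y : E d) : 0 ≤ nearInd ρ b z y := by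
  unfold nearInd
  split_ifs <;> norm_num

lemma nearInd_eq_zero_or_one (ρ b : ℝ) (z y : E d) : nearInd ρ b z y = 0 ∨ nearInd ρ b z y = 1 := by
  unfold nearInd
  split_ifs <;> simp

lemma nonempty_coe_sort {I : Finset ℕ} (hI : I.Nonempty) : Nonempty I := hI.to_subtype

lemma faceInd_nonneg (hh : IsAdmissible h) (t ρ : ℝ) (x : ℕ → E d) {I : Finset ℕ}
    (hI : I.Nonempty) : 0 ≤ faceInd h t ρ x I := by
  have := nonempty_coe_sort hI
  have := hh.scaled_nonneg t (pointSet_nonempty fun i : I => x i)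
  unfold faceInd
  positivity

lemma faceInd_le_one (hh : IsAdmissible h) (t ρ : ℝ) (x : ℕ → E d) {I : Finset ℕ}
    (hI : I.Nonempty) : faceInd h t ρ x I ≤ 1 := by
  have := nonempty_coe_sort hI
  have := hh.scaled_le_one t (pointSet_nonempty fun i : I => x i)
  unfold faceInd
  split_ifs <;> simp [this]

lemma faceInd_mono (hh : IsAdmissible h) {t t' ρ ρ' : ℝ} (ht : 0 ≤ t) (htt' : t ≤ t')
    (hρ : ρ' ≤ ρ) (x : ℕ → E d) {I : Finset ℕ} (hI : I.Nonempty) :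
    faceInd h t ρ x I ≤ faceInd h t' ρ' x I := by
  have := nonempty_coe_sort hI
  have hne := pointSet_nonempty fun i : I => x i
  have h0 := hh.scaled_nonneg t hne
  have h1 := hh.scaled_mono_zero ht htt' hne
  unfold faceInd
  by_cases hx : ∀ i ∈ I, ρ ≤ ‖x i‖
  · rw [if_pos hx, if_pos fun i hi => hρ.trans (hx i hi)]
    linarith
  · rw [if_neg hx, mul_zero]
    exact mul_nonneg (h0.trans h1) (by positivity)

lemma faceCount_mono (hh : IsAdmissible h) {t t' ρ ρ' : ℝ} (ht : 0 ≤ t) (htt' : t ≤ t')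
    (hρ : ρ' ≤ ρ) (x : ℕ → E d) {𝓕 𝓕' : Finset (Finset ℕ)} (hF : 𝓕 ⊆ 𝓕')
    (hne : ∀ I ∈ 𝓕', I.Nonempty) : faceCount h t ρ 𝓕 x ≤ faceCount h t' ρ' 𝓕' x := by
  unfold faceCount
  refine (Finset.sum_le_sum fun I hI => faceInd_mono hh ht htt' hρ x (hne I (hF hI))).trans ?_
  exact Finset.sum_le_sum_of_subset_of_nonneg hF fun I hI _ => faceInd_nonneg hh _ _ x (hne I hI)

lemma simplexCount_eq_faceCount {Ω : Type*} (X : ℕ → Ω → E d) (R : ℝ) (k n : ℕ) (t : ℝ) {ω : Ω}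
    (hinj : Function.Injective fun i => X i ω) : simplexCount h X R k n t ω =
      faceCount h t R ((Finset.range n).powersetCard (k + 1)) fun i => X i ω := by
  have hs : sample X n ω = (Finset.range n).map ⟨fun i => X i ω, hinj⟩ := by
    ext y
    simp only [sample, mem_pointSet, Finset.mem_map, Finset.mem_range, Function.Embedding.coeFn_mk]
    exact ⟨fun ⟨i, hi⟩ => ⟨i, i.2, hi⟩, fun ⟨i, hi, hy⟩ => ⟨⟨i, hi⟩, hy⟩⟩
  unfold simplexCount faceCount
  rw [hs, Finset.powersetCard_map, Finset.sum_map]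
  refine Finset.sum_congr rfl fun I _ => ?_
  have hI : ((Finset.mapEmbedding ⟨fun i => X i ω, hinj⟩).toEmbedding I)
      = pointSet fun i : I => X i ω := by
    ext y
    simp [mem_pointSet]
  rw [hI, faceInd]
  congr 1
  refine if_congr ?_ rfl rfl
  simp only [mem_pointSet]
  exact ⟨fun hy i hi => hy _ ⟨⟨i, hi⟩, rfl⟩, fun hi y ⟨i, hy⟩ => hy ▸ hi i i.2⟩

/-- All points of a simplex are outside the ball and near any given one of them. -/
lemma faceInd_le_prod (hh : IsAdmissible h) {c t : ℝ}
    (hc : ∀ 𝒳 : Finset (E d), 𝒳.Nonempty → scaled h t 𝒳 ≠ 0 → ∀ x ∈ 𝒳, ∀ y ∈ 𝒳, dist x y ≤ c)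
    (ρ : ℝ) (x : ℕ → E d) {I : Finset ℕ} {i : ℕ} (hi : i ∈ I) :
    faceInd h t ρ x I ≤
      (if ρ ≤ ‖x i‖ then 1 else 0) * ∏ j ∈ I.erase i, nearInd ρ c (x i) (x j) := by
  have hIne : I.Nonempty := ⟨i, hi⟩
  have := nonempty_coe_sort hIne
  by_cases h0 : faceInd h t ρ x I = 0
  · rw [h0]
    exact mul_nonneg (by positivity) (Finset.prod_nonneg fun j _ => nearInd_nonneg _ _ _ _)
  · have h1 : scaled h t (pointSet fun i : I => x i) ≠ 0 := left_ne_zero_of_mul h0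
    have h2 : ∀ i ∈ I, ρ ≤ ‖x i‖ := by
      by_contra hcon
      exact right_ne_zero_of_mul h0 (if_neg hcon)
    rw [if_pos (h2 i hi), one_mul, Finset.prod_eq_one]
    · exact faceInd_le_one hh t ρ x hIne
    · intro j hj
      have hj := Finset.mem_of_mem_erase hj
      exact if_pos ⟨h2 j hj, hc _ (pointSet_nonempty _) h1 _ (mem_pointSet.2 ⟨⟨j, hj⟩, rfl⟩) _
        (mem_pointSet.2 ⟨⟨i, hi⟩, rfl⟩)⟩

lemma sum_erase_eq_sum_powerset {s : Finset ℕ} {i : ℕ} (hi : i ∈ s) (F : Finset ℕ → ℝ) :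
    ∑ I ∈ s.powerset with i ∈ I, F (I.erase i) = ∑ J ∈ (s.erase i).powerset, F J := by
  refine Finset.sum_nbij' (fun I => I.erase i) (fun J => insert i J) ?_ ?_ ?_ ?_ ?_
  · intro I hI
    rw [Finset.mem_filter, Finset.mem_powerset] at hI
    exact Finset.mem_powerset.2 (Finset.erase_subset_erase i hI.1)
  · intro J hJ
    rw [Finset.mem_powerset] at hJ
    rw [Finset.mem_filter, Finset.mem_powerset]
    exact ⟨Finset.insert_subset hi (hJ.trans (Finset.erase_subset _ _)), Finset.mem_insert_self _ _⟩
  · intro I hI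
    exact Finset.insert_erase (Finset.mem_filter.1 hI).2
  · intro J hJ
    exact Finset.erase_insert fun h => by simpa using Finset.mem_powerset.1 hJ h
  · intro I _
    rfl

/-- The pairs of intersecting index sets of simplices with a common index `i` number at most
`4 ^ D_i`, as either index set consists of `i` and some of the `D_i` neighbours. -/
lemma sum_faceInd_mul_le_degreeWeight (hh : IsAdmissible h) {c t : ℝ}
    (hc : ∀ 𝒳 : Finset (E d), 𝒳.Nonempty → scaled h t 𝒳 ≠ 0 → ∀ x ∈ 𝒳, ∀ y ∈ 𝒳, dist x y ≤ c)
    (ρ : ℝ) (x : ℕ → E d) {n : ℕ} {𝓕 : Finset (Finset ℕ)} (hF : 𝓕 ⊆ (Finset.range n).powerset)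
    (hne : ∀ I ∈ 𝓕, I.Nonempty) :
    ∑ p ∈ 𝓕 ×ˢ 𝓕 with ¬ Disjoint p.1 p.2, faceInd h t ρ x p.1 * faceInd h t ρ x p.2
      ≤ degreeWeight ρ c n x := by
  have hnn : ∀ I ∈ 𝓕, 0 ≤ faceInd h t ρ x I := fun I hI => faceInd_nonneg hh t ρ x (hne I hI)
  have hstep : ∀ i ∈ Finset.range n, (∑ I ∈ 𝓕 with i ∈ I, faceInd h t ρ x I) ^ 2 ≤
      (if ρ ≤ ‖x i‖ then 1 else 0) *
        ∏ j ∈ (Finset.range n).erase i, (1 + 3 * nearInd ρ c (x i) (x j)) := by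
    intro i hi
    have h1 : ∑ I ∈ 𝓕 with i ∈ I, faceInd h t ρ x I ≤ (if ρ ≤ ‖x i‖ then 1 else 0) *
        ∏ j ∈ (Finset.range n).erase i, (1 + nearInd ρ c (x i) (x j)) := by
      rw [Finset.prod_one_add, ← sum_erase_eq_sum_powerset hi, Finset.mul_sum]
      refine (Finset.sum_le_sum fun I hI => faceInd_le_prod hh hc ρ x
        (Finset.mem_filter.1 hI).2).trans ?_
      refine Finset.sum_le_sum_of_subset_of_nonneg (Finset.filter_subset_filter _ hF)
        fun I _ _ => ?_
      exact mul_nonneg (by positivity) (Finset.prod_nonneg fun j _ => nearInd_nonneg _ _ _ _)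
    have h0 : 0 ≤ ∑ I ∈ 𝓕 with i ∈ I, faceInd h t ρ x I :=
      Finset.sum_nonneg fun I hI => hnn I (Finset.mem_filter.1 hI).1
    refine (pow_le_pow_left₀ h0 h1 2).trans (le_of_eq ?_)
    rw [mul_pow, ← Finset.prod_pow]
    congr 1
    · split_ifs <;> simp
    · refine Finset.prod_congr rfl fun j _ => ?_
      rcases nearInd_eq_zero_or_one ρ c (x i) (x j) with h | h <;> rw [h] <;> norm_num
  refine le_trans ?_ (Finset.sum_le_sum hstep)
  -- every pair of intersecting index sets is counted once for each common index
  have hpair : ∀ p ∈ (𝓕 ×ˢ 𝓕).filter (fun p => ¬ Disjoint p.1 p.2),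
      faceInd h t ρ x p.1 * faceInd h t ρ x p.2 ≤
        ∑ i ∈ Finset.range n, if i ∈ p.1 ∧ i ∈ p.2 then
          faceInd h t ρ x p.1 * faceInd h t ρ x p.2 else 0 := by
    intro p hp
    rw [Finset.mem_filter, Finset.mem_product, Finset.not_disjoint_iff] at hp
    obtain ⟨⟨h1, h2⟩, i, hi1, hi2⟩ := hp
    have hpos := mul_nonneg (hnn _ h1) (hnn _ h2)
    have := Finset.single_le_sum (f := fun i => if i ∈ p.1 ∧ i ∈ p.2 then
      faceInd h t ρ x p.1 * faceInd h t ρ x p.2 else 0) (fun j _ => by positivity)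
      (Finset.mem_powerset.1 (hF h1) hi1)
    simpa [hi1, hi2] using this
  refine (Finset.sum_le_sum hpair).trans ?_
  rw [Finset.sum_comm]
  refine Finset.sum_le_sum fun i _ => ?_
  rw [sq, Finset.sum_mul_sum, ← Finset.sum_product', ← Finset.filter_product, Finset.sum_filter,
    Finset.sum_filter]
  refine Finset.sum_le_sum fun p hp => ?_
  rw [Finset.mem_product] at hp
  have hpos := mul_nonneg (hnn _ hp.1) (hnn _ hp.2)
  split_ifs <;> simp_all

/-- The family of the index sets in `{0, …, n - 1}` of the simplices of dimension at least `K`. -/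
def highFaces (K n : ℕ) : Finset (Finset ℕ) := (Finset.range n).powerset.filter (K + 1 ≤ ·.card)

/-- A simplex of dimension at least `K` at the `i`-th point is given by at least `K` of the `D_i`
neighbours, and `2 ^ K` times the number of such choices is at most
`∑ J, 2 ^ |J| = 3 ^ D_i ≤ 4 ^ D_i`. -/
lemma faceCount_highFaces_le (hh : IsAdmissible h) {c t : ℝ}
    (hc : ∀ 𝒳 : Finset (E d), 𝒳.Nonempty → scaled h t 𝒳 ≠ 0 → ∀ x ∈ 𝒳, ∀ y ∈ 𝒳, dist x y ≤ c)
    (ρ : ℝ) (x : ℕ → E d) (K n : ℕ) :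
    faceCount h t ρ (highFaces K n) x ≤ (1 / 2) ^ K * degreeWeight ρ c n x := by
  have hne : ∀ I ∈ highFaces K n, I.Nonempty := fun I hI => by
    rw [← Finset.card_pos]
    have := (Finset.mem_filter.1 hI).2
    omega
  have hstep : ∀ i ∈ Finset.range n, ∑ I ∈ highFaces K n with i ∈ I, faceInd h t ρ x I ≤
      (1 / 2) ^ K * ((if ρ ≤ ‖x i‖ then 1 else 0) *
        ∏ j ∈ (Finset.range n).erase i, (1 + 3 * nearInd ρ c (x i) (x j))) := by
    intro i hi
    have h1 : ∀ I ∈ (highFaces K n).filter (i ∈ ·), faceInd h t ρ x I ≤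
        (1 / 2) ^ K * ((if ρ ≤ ‖x i‖ then 1 else 0) *
          ∏ j ∈ I.erase i, (2 * nearInd ρ c (x i) (x j))) := by
      intro I hI
      have hiI := (Finset.mem_filter.1 hI).2
      refine (faceInd_le_prod hh hc ρ x hiI).trans ?_
      rw [Finset.prod_mul_distrib, Finset.prod_const, Finset.card_erase_of_mem hiI]
      have hcard : K ≤ I.card - 1 := by
        have := (Finset.mem_filter.1 (Finset.mem_filter.1 hI).1).2
        omega
      have hpow : (1 : ℝ) ≤ (1 / 2) ^ K * 2 ^ (I.card - 1) := by
        rw [one_div, inv_pow, ← div_eq_inv_mul, one_le_div (by positivity)]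
        exact pow_le_pow_right₀ (by norm_num) hcard
      have hnn : 0 ≤ (if ρ ≤ ‖x i‖ then (1 : ℝ) else 0) *
          ∏ j ∈ I.erase i, nearInd ρ c (x i) (x j) :=
        mul_nonneg (by positivity) (Finset.prod_nonneg fun j _ => nearInd_nonneg _ _ _ _)
      calc _ ≤ ((1 / 2) ^ K * 2 ^ (I.card - 1)) * ((if ρ ≤ ‖x i‖ then (1 : ℝ) else 0) *
            ∏ j ∈ I.erase i, nearInd ρ c (x i) (x j)) := le_mul_of_one_le_left hnn hpow
        _ = _ := by ring
    refine (Finset.sum_le_sum h1).trans ?_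
    rw [← Finset.mul_sum, ← Finset.mul_sum]
    refine mul_le_mul_of_nonneg_left (mul_le_mul_of_nonneg_left ?_ (by positivity)) (by positivity)
    have h2 : ∏ j ∈ (Finset.range n).erase i, (1 + 2 * nearInd ρ c (x i) (x j)) ≤
        ∏ j ∈ (Finset.range n).erase i, (1 + 3 * nearInd ρ c (x i) (x j)) := by
      refine Finset.prod_le_prod (fun j _ => ?_) fun j _ => ?_ <;>
        linarith [nearInd_nonneg ρ c (x i) (x j)]
    refine le_trans ?_ h2
    rw [Finset.prod_one_add, ← sum_erase_eq_sum_powerset hi]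
    refine Finset.sum_le_sum_of_subset_of_nonneg
      (Finset.filter_subset_filter _ (Finset.filter_subset _ _)) fun I _ _ => ?_
    exact Finset.prod_nonneg fun j _ => mul_nonneg zero_le_two (nearInd_nonneg _ _ _ _)
  rw [degreeWeight, Finset.mul_sum]
  refine le_trans ?_ (Finset.sum_le_sum hstep)
  simp_rw [Finset.sum_filter]
  rw [Finset.sum_comm]
  refine Finset.sum_le_sum fun I hI => ?_
  have hpos := faceInd_nonneg hh t ρ x (hne I hI)
  obtain ⟨i, hi⟩ := hne I hI
  have := Finset.single_le_sum (f := fun i => if i ∈ I then faceInd h t ρ x I else 0)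
    (fun j _ => by positivity) (Finset.mem_powerset.1 (Finset.mem_filter.1 hI).1 hi)
  simpa [hi] using this

end GeomComplex

/-! ### Products of pair weights over an independent sample -/

/-- If, for each fixed `z`, the weight `w z (X j)` has mean at most `M`, then the product over the
indices `j ∈ J` of the weights `w (X i) (X j)` contributes at most `M ^ |J|` to an expectation. -/
lemma lintegral_mul_prod_le {Ω 𝓧 : Type*} [MeasurableSpace Ω] [MeasurableSpace 𝓧] {P : Measure Ω}
    [IsProbabilityMeasure P] {X : ℕ → Ω → 𝓧} (hX : ∀ i, Measurable (X i)) (hind : iIndepFun X P)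
    {u : 𝓧 → ENNReal} (hu : Measurable u) {w : 𝓧 → 𝓧 → ENNReal}
    (hw : Measurable (Function.uncurry w)) {M : ENNReal}
    (hM : ∀ j z, ∫⁻ ω, w z (X j ω) ∂P ≤ M) (i : ℕ) (J : Finset ℕ) (hi : i ∉ J) :
    ∫⁻ ω, u (X i ω) * ∏ j ∈ J, w (X i ω) (X j ω) ∂P ≤ M ^ J.card * ∫⁻ ω, u (X i ω) ∂P := by
  induction J using Finset.induction_on with
  | empty => simp
  | insert a J ha ih =>
    have hia : i ≠ a := fun hc => hi (hc ▸ Finset.mem_insert_self _ _)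
    have hiJ : i ∉ J := fun hc => hi (Finset.mem_insert_of_mem hc)
    set S := insert i J with hS
    have hdisj : Disjoint S {a} := by
      rw [Finset.disjoint_singleton_right, hS, Finset.mem_insert, not_or]
      exact ⟨hia.symm, ha⟩
    set Z : Ω → S → 𝓧 := fun ω s => X s ω with hZ
    have hZm : Measurable Z := measurable_pi_iff.2 fun s => hX s
    have hev : ∀ s : S, Measurable fun z : S → 𝓧 => z s := measurable_pi_apply
    have hZX : IndepFun Z (X a) P := by
      have hea : Measurable fun y : ({a} : Finset ℕ) → 𝓧 => y ⟨a, Finset.mem_singleton_self a⟩ :=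
        measurable_pi_apply _
      exact (hind.indepFun_finset S {a} hdisj hX).comp measurable_id hea
    have hiS : i ∈ S := Finset.mem_insert_self _ _
    have hJS : ∀ j ∈ J, j ∈ S := fun j hj => Finset.mem_insert_of_mem hj
    set Y : (S → 𝓧) → ENNReal := fun z =>
      u (z ⟨i, hiS⟩) * ∏ j : J, w (z ⟨i, hiS⟩) (z ⟨j, hJS j j.2⟩) with hY
    have hYm : Measurable Y := by
      refine (hu.comp (hev _)).mul (Finset.measurable_prod _ fun j _ => ?_)
      exact hw.comp ((hev ⟨i, hiS⟩).prodMk (hev ⟨j, hJS j j.2⟩))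
    have hYZ : ∀ ω, Y (Z ω) = u (X i ω) * ∏ j ∈ J, w (X i ω) (X j ω) := by
      intro ω
      simp only [hY, hZ]
      rw [Finset.prod_coe_sort J fun j => w (X i ω) (X j ω)]
    have hG : Measurable fun p : (S → 𝓧) × 𝓧 => Y p.1 * w (p.1 ⟨i, hiS⟩) p.2 := by
      exact (hYm.comp measurable_fst).mul
        (hw.comp (((hev ⟨i, hiS⟩).comp measurable_fst).prodMk measurable_snd))
    have h1 : ∫⁻ ω, u (X i ω) * ∏ j ∈ insert a J, w (X i ω) (X j ω) ∂P
        = ∫⁻ p, Y p.1 * w (p.1 ⟨i, hiS⟩) p.2 ∂((P.map Z).prod (P.map (X a))) := by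
      rw [← hZX.map_prod_eq_prod_map_map hZm.aemeasurable (hX a).aemeasurable,
        lintegral_map hG (hZm.prodMk (hX a))]
      refine lintegral_congr fun ω => ?_
      rw [hYZ, Finset.prod_insert ha]
      simp only [hZ]
      ring
    rw [h1, lintegral_prod _ hG.aemeasurable]
    calc ∫⁻ z, ∫⁻ y, Y z * w (z ⟨i, hiS⟩) y ∂(P.map (X a)) ∂(P.map Z)
        ≤ ∫⁻ z, Y z * M ∂(P.map Z) := by
          refine lintegral_mono fun z => ?_
          have hwz : Measurable (w (z ⟨i, hiS⟩)) := hw.comp measurable_prodMk_left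
          rw [lintegral_const_mul _ hwz, lintegral_map hwz (hX a)]
          exact mul_le_mul_right (hM a _) _
      _ = M * ∫⁻ ω, u (X i ω) * ∏ j ∈ J, w (X i ω) (X j ω) ∂P := by
          rw [lintegral_mul_const _ hYm, mul_comm, lintegral_map hYm hZm]
          simp_rw [hYZ]
      _ ≤ M * (M ^ J.card * ∫⁻ ω, u (X i ω) ∂P) := mul_le_mul_right (ih hiJ) _
      _ = _ := by rw [Finset.card_insert_of_notMem ha, pow_succ]; ring

/-- The product of copies of a measure with density has the product density. -/
lemma pi_withDensity_ofReal {𝓧 ι : Type*} [Fintype ι] [MeasurableSpace 𝓧] {ν : Measure 𝓧}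
    [SigmaFinite ν] {f : 𝓧 → ℝ} (hf : ∀ x, 0 ≤ f x) (hfi : Integrable f ν) :
    Measure.pi (fun _ : ι => ν.withDensity fun x => ENNReal.ofReal (f x)) =
      (Measure.pi fun _ : ι => ν).withDensity fun x => ENNReal.ofReal (∏ i, f (x i)) := by
  have : IsFiniteMeasure (ν.withDensity fun x => ENNReal.ofReal (f x)) :=
    isFiniteMeasure_withDensity_ofReal hfi.2
  refine Measure.pi_eq fun s hs => ?_
  rw [withDensity_apply _ (MeasurableSet.univ_pi hs)]
  have hprod : ∀ x : ι → 𝓧, (univ.pi s).indicator (fun x => ENNReal.ofReal (∏ i, f (x i))) x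
      = ENNReal.ofReal (∏ i, (s i).indicator f (x i)) := by
    intro x
    by_cases hx : x ∈ univ.pi s
    · rw [indicator_of_mem hx]
      congr 1
      exact Finset.prod_congr rfl fun i _ => (indicator_of_mem (hx i (mem_univ i)) f).symm
    · rw [indicator_of_notMem hx]
      obtain ⟨i, hi⟩ : ∃ i, x i ∉ s i := by simpa [Set.mem_pi] using hx
      rw [Finset.prod_eq_zero (Finset.mem_univ i) (indicator_of_notMem hi f), ENNReal.ofReal_zero]
  have hi : ∀ i, Integrable ((s i).indicator f) ν := fun i => hfi.indicator (hs i)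
  have hnn : ∀ i x, 0 ≤ (s i).indicator f x := fun i x => indicator_nonneg (fun x _ => hf x) x
  rw [← lintegral_indicator (MeasurableSet.univ_pi hs)]
  simp_rw [hprod]
  rw [← ofReal_integral_eq_lintegral_ofReal (Integrable.fintype_prod hi)
    (Eventually.of_forall fun x => Finset.prod_nonneg fun i _ => hnn i _),
    integral_fintype_prod_eq_prod, ENNReal.ofReal_prod_of_nonneg fun i _ => integral_nonneg (hnn i)]
  refine Finset.prod_congr rfl fun i _ => ?_
  rw [ofReal_integral_eq_lintegral_ofReal (hi i) (Eventually.of_forall (hnn i)),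
    withDensity_apply _ (hs i), ← lintegral_indicator (hs i)]
  refine lintegral_congr fun x => ?_
  by_cases hx : x ∈ s i <;> simp [hx]

namespace GeomComplex

/-! ### Moments of simplex counts of an independent sample -/

variable {d : ℕ} {h : Finset (E d) → ℝ}

lemma IsSphericalDensity.integrable {f : E d → ℝ} (hf : IsSphericalDensity f) : Integrable f := by
  refine ⟨hf.measurable.aestronglyMeasurable, ?_⟩
  rw [hasFiniteIntegral_iff_ofReal (Eventually.of_forall hf.nonneg), hf.total]
  exact ENNReal.one_lt_top

/-- An independent sequence of random points with density `f`. -/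
structure IsSample {Ω : Type*} [MeasurableSpace Ω] (P : Measure Ω) (X : ℕ → Ω → E d)
    (f : E d → ℝ) : Prop where
  measurable : ∀ i, Measurable (X i)
  indep : iIndepFun X P
  law : ∀ i, P.map (X i) = volume.withDensity fun x => ENNReal.ofReal (f x)
  density : IsSphericalDensity f

open Classical in
/-- The indicator that a finite tuple of points lies outside the open ball of radius `ρ` and forms a
simplex of parameter `t`. -/
noncomputable def tupleInd (h : Finset (E d) → ℝ) (t ρ : ℝ) {ι : Type*} [Fintype ι]
    (y : ι → E d) : ℝ :=
  scaled h t (pointSet y) * if ∀ i, ρ ≤ ‖y i‖ then 1 else 0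

lemma faceInd_eq_tupleInd (t ρ : ℝ) (x : ℕ → E d) (I : Finset ℕ) :
    faceInd h t ρ x I = tupleInd h t ρ fun i : I => x i := by
  unfold faceInd tupleInd
  congr 1
  exact if_congr (by simp) rfl rfl

lemma tupleInd_comp_equiv (t ρ : ℝ) {ι κ : Type*} [Fintype ι] [Fintype κ] (e : ι ≃ κ)
    (y : κ → E d) : tupleInd h t ρ (fun i => y (e i)) = tupleInd h t ρ y := by
  unfold tupleInd
  rw [pointSet_comp_equiv]
  congr 1
  exact if_congr (e.forall_congr_left.trans (by simp)) rfl rfl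

lemma measurable_tupleInd (hh : IsAdmissible h) (t ρ : ℝ) {ι : Type*} [Fintype ι] [Nonempty ι] :
    Measurable (tupleInd (d := d) h t ρ (ι := ι)) := by
  refine (hh.measurable_scaled t).mul (Measurable.ite ?_ measurable_const measurable_const)
  simp only [ofPred_forall]
  exact MeasurableSet.iInter fun i =>
    measurableSet_le measurable_const (measurable_pi_apply i).norm

lemma tupleInd_mul_prod (t ρ : ℝ) (f : E d → ℝ) {ι : Type*} [Fintype ι] (y : ι → E d) :
    (∏ i, f (y i)) * tupleInd h t ρ y = scaled h t (pointSet y) * ∏ i, outerPart f ρ (y i) := by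
  unfold tupleInd outerPart
  by_cases hy : ∀ i, ρ ≤ ‖y i‖
  · simp only [hy, implies_true, if_true, mul_one]
    ring
  · rw [if_neg hy, mul_zero, mul_zero]
    push Not at hy
    obtain ⟨i, hi⟩ := hy
    rw [Finset.prod_eq_zero (Finset.mem_univ i) (if_neg (not_le.2 hi)), mul_zero]

lemma measurable_nearInd (ρ b : ℝ) : Measurable (Function.uncurry (nearInd (d := d) ρ b)) := by
  refine Measurable.ite ?_ measurable_const measurable_const
  refine (measurableSet_le measurable_const measurable_snd.norm).inter
    (measurableSet_le (measurable_snd.dist measurable_fst) measurable_const)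

namespace IsSample

variable {Ω : Type*} [MeasurableSpace Ω] {P : Measure Ω}
  {X : ℕ → Ω → E d} {f : E d → ℝ} (hS : IsSample P X f)
include hS

lemma measurable_faceInd (hh : IsAdmissible h) (t ρ : ℝ) {I : Finset ℕ} (hI : I.Nonempty) :
    Measurable fun ω => faceInd h t ρ (fun i => X i ω) I := by
  have := nonempty_coe_sort hI
  simp_rw [faceInd_eq_tupleInd]
  exact (measurable_tupleInd hh t ρ).comp (measurable_pi_iff.2 fun i : I => hS.measurable i)

lemma indepFun_faceInd (hh : IsAdmissible h) (t ρ : ℝ) {I J : Finset ℕ} (hI : I.Nonempty)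
    (hJ : J.Nonempty) (hIJ : Disjoint I J) :
    IndepFun (fun ω => faceInd h t ρ (fun i => X i ω) I)
      (fun ω => faceInd h t ρ (fun i => X i ω) J) P := by
  have := nonempty_coe_sort hI
  have := nonempty_coe_sort hJ
  simp_rw [faceInd_eq_tupleInd]
  exact (hS.indep.indepFun_finset I J hIJ hS.measurable).comp (measurable_tupleInd hh t ρ)
    (measurable_tupleInd hh t ρ)

lemma measurable_degreeTerm (ρ b : ℝ) (i : ℕ) (J : Finset ℕ) :
    Measurable fun ω => (if ρ ≤ ‖X i ω‖ then (1 : ℝ) else 0) *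
      ∏ j ∈ J, (1 + 3 * nearInd ρ b (X i ω) (X j ω)) := by
  refine Measurable.mul (Measurable.ite (measurableSet_le measurable_const (hS.measurable i).norm)
    measurable_const measurable_const) (Finset.measurable_prod _ fun j _ => ?_)
  exact (((measurable_nearInd ρ b).comp
    ((hS.measurable i).prodMk (hS.measurable j))).const_mul 3).const_add 1

lemma lintegral_comp_sample {g : E d → ENNReal} (hg : Measurable g) (j : ℕ) :
    ∫⁻ ω, g (X j ω) ∂P = ∫⁻ y, ENNReal.ofReal (f y) * g y := by
  rw [← lintegral_map hg (hS.measurable j), hS.law,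
    lintegral_withDensity_eq_lintegral_mul _ hS.density.measurable.ennreal_ofReal hg]
  rfl

lemma lintegral_nearInd_le_mul {ρ b B : ℝ} (hB : ∀ x, outerPart f ρ x ≤ B) (j : ℕ) (z : E d) :
    ∫⁻ ω, ENNReal.ofReal (nearInd ρ b z (X j ω)) ∂P ≤
      ENNReal.ofReal (B * volume.real (Metric.closedBall (0 : E d) b)) := by
  have hB0 : 0 ≤ B := (outerPart_nonneg hS.density.nonneg ρ 0).trans (hB 0)
  have hnm : Measurable fun y => ENNReal.ofReal (nearInd ρ b z y) :=
    ((measurable_nearInd ρ b).comp measurable_prodMk_left).ennreal_ofReal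
  have hpt : ∀ y, ENNReal.ofReal (f y) * ENNReal.ofReal (nearInd ρ b z y) ≤
      (Metric.closedBall z b).indicator (fun _ => ENNReal.ofReal B) y := by
    intro y
    by_cases hy : ρ ≤ ‖y‖ ∧ dist y z ≤ b
    · rw [nearInd, if_pos hy, indicator_of_mem (Metric.mem_closedBall.2 hy.2), ENNReal.ofReal_one,
        mul_one]
      refine ENNReal.ofReal_le_ofReal ?_
      have := hB y
      rwa [outerPart, if_pos hy.1] at this
    · rw [nearInd, if_neg hy, ENNReal.ofReal_zero, mul_zero]
      exact zero_le
  rw [hS.lintegral_comp_sample hnm j]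
  refine (lintegral_mono hpt).trans (le_of_eq ?_)
  rw [lintegral_indicator Metric.isClosed_closedBall.measurableSet, lintegral_const,
    Measure.restrict_apply_univ, ENNReal.ofReal_mul hB0,
    ofReal_measureReal measure_closedBall_lt_top.ne, Measure.addHaar_closedBall_center]

variable [IsProbabilityMeasure P]

lemma memLp_faceInd (hh : IsAdmissible h) (t ρ : ℝ) {I : Finset ℕ} (hI : I.Nonempty)
    (p : ENNReal) : MemLp (fun ω => faceInd h t ρ (fun i => X i ω) I) p P := by
  refine MemLp.of_bound (hS.measurable_faceInd hh t ρ hI).aestronglyMeasurable 1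
    (Eventually.of_forall fun ω => ?_)
  rw [Real.norm_of_nonneg (faceInd_nonneg hh t ρ _ hI)]
  exact faceInd_le_one hh t ρ _ hI

lemma integral_faceInd (hh : IsAdmissible h) (t ρ : ℝ) {I : Finset ℕ} {k : ℕ}
    (hI : I.card = k + 1) :
    ∫ ω, faceInd h t ρ (fun i => X i ω) I ∂P = simplexIntegral h f k t ρ := by
  let e : Fin (k + 1) ≃ I := (Finset.equivFinOfCardEq hI).symm
  have hm : Measurable fun (ω : Ω) (j : Fin (k + 1)) => X (e j) ω :=
    measurable_pi_iff.2 fun j => hS.measurable _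
  have hlaw : P.map (fun ω (j : Fin (k + 1)) => X (e j) ω) =
      volume.withDensity fun y : Fin (k + 1) → E d => ENNReal.ofReal (∏ i, f (y i)) := by
    have hinj : Function.Injective fun j : Fin (k + 1) => (e j : ℕ) :=
      Subtype.val_injective.comp e.injective
    rw [(iIndepFun_iff_map_fun_eq_pi_map fun j => (hS.measurable _).aemeasurable).1
      (hS.indep.precomp hinj)]
    simp_rw [hS.law]
    exact pi_withDensity_ofReal hS.density.nonneg hS.density.integrable
  have hfm : Measurable fun y : Fin (k + 1) → E d => ∏ i, f (y i) :=
    Finset.measurable_prod _ fun i _ => hS.density.measurable.comp (measurable_pi_apply i)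
  calc ∫ ω, faceInd h t ρ (fun i => X i ω) I ∂P
      = ∫ ω, tupleInd h t ρ (fun j : Fin (k + 1) => X (e j) ω) ∂P := by
        refine integral_congr_ae (Eventually.of_forall fun ω => ?_)
        simp only [faceInd_eq_tupleInd]
        exact (tupleInd_comp_equiv t ρ e fun i : I => X i ω).symm
    _ = ∫ y : Fin (k + 1) → E d, tupleInd h t ρ y ∂(P.map fun ω j => X (e j) ω) :=
        (integral_map hm.aemeasurable (measurable_tupleInd hh t ρ).aestronglyMeasurable).symm
    _ = simplexIntegral h f k t ρ := by
        rw [hlaw, integral_withDensity_eq_integral_toReal_smul hfm.ennreal_ofReal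
          (Eventually.of_forall fun _ => ENNReal.ofReal_lt_top)]
        refine integral_congr_ae (Eventually.of_forall fun y => ?_)
        simp only [smul_eq_mul]
        rw [ENNReal.toReal_ofReal (Finset.prod_nonneg fun i _ => hS.density.nonneg _),
          tupleInd_mul_prod]

lemma integral_faceCount_powersetCard (hh : IsAdmissible h) (t ρ : ℝ) (k n : ℕ) :
    ∫ ω, faceCount h t ρ ((Finset.range n).powersetCard (k + 1)) (fun i => X i ω) ∂P =
      n.choose (k + 1) * simplexIntegral h f k t ρ := by
  unfold faceCount
  have hne : ∀ I ∈ (Finset.range n).powersetCard (k + 1), I.Nonempty := fun I hI => by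
    rw [← Finset.card_pos, (Finset.mem_powersetCard.1 hI).2]
    omega
  rw [integral_finsetSum _ fun I hI => (hS.memLp_faceInd hh t ρ (hne I hI) 1).integrable le_rfl,
    Finset.sum_congr rfl fun I hI => hS.integral_faceInd hh t ρ (Finset.mem_powersetCard.1 hI).2,
    Finset.sum_const, Finset.card_powersetCard, Finset.card_range, nsmul_eq_mul]

lemma integrable_degreeTerm (ρ b : ℝ) (i : ℕ) (J : Finset ℕ) :
    Integrable (fun ω => (if ρ ≤ ‖X i ω‖ then (1 : ℝ) else 0) *
      ∏ j ∈ J, (1 + 3 * nearInd ρ b (X i ω) (X j ω))) P := by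
  refine (MemLp.of_bound (hS.measurable_degreeTerm ρ b i J).aestronglyMeasurable (4 ^ J.card)
    (Eventually.of_forall fun ω => ?_)).integrable le_rfl
  have h1 : ∀ j ∈ J, 0 ≤ 1 + 3 * nearInd ρ b (X i ω) (X j ω) := fun j _ => by
    linarith [nearInd_nonneg ρ b (X i ω) (X j ω)]
  have h2 : ∏ j ∈ J, (1 + 3 * nearInd ρ b (X i ω) (X j ω)) ≤ 4 ^ J.card := by
    rw [← Finset.prod_const]
    refine Finset.prod_le_prod h1 fun j _ => ?_
    rcases nearInd_eq_zero_or_one ρ b (X i ω) (X j ω) with h | h <;> rw [h] <;> norm_num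
  rw [Real.norm_of_nonneg (mul_nonneg (by positivity) (Finset.prod_nonneg h1))]
  split_ifs
  · rwa [one_mul]
  · rw [zero_mul]
    positivity

lemma integrable_degreeWeight (ρ b : ℝ) (n : ℕ) :
    Integrable (fun ω => degreeWeight ρ b n fun i => X i ω) P :=
  integrable_finsetSum _ fun _ _ => hS.integrable_degreeTerm ρ b _ _

lemma integral_outer_eq (hh : IsAdmissible h) (t ρ : ℝ) (i : ℕ) :
    ∫ ω, (if ρ ≤ ‖X i ω‖ then (1 : ℝ) else 0) ∂P = simplexIntegral h f 0 t ρ := by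
  rw [← hS.integral_faceInd hh t ρ (I := {i}) (k := 0) (by simp)]
  refine integral_congr_ae (Eventually.of_forall fun ω => ?_)
  have : (pointSet fun j : ({i} : Finset ℕ) => X j ω) = {X i ω} := by
    ext y
    simp [mem_pointSet, eq_comm]
  simp [faceInd, this, hh.scaled_singleton]

/-- The mean of the pair weight is governed by the mass that the law of one point gives to a ball,
which is at most `B` times the volume of the ball. -/
lemma lintegral_nearInd_le {ρ b B : ℝ} (hB : ∀ x, outerPart f ρ x ≤ B) (j : ℕ) (z : E d) :
    ∫⁻ ω, ENNReal.ofReal (1 + 3 * nearInd ρ b z (X j ω)) ∂P ≤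
      ENNReal.ofReal (1 + 3 * (B * volume.real (Metric.closedBall (0 : E d) b))) := by
  have hB0 : 0 ≤ B := (outerPart_nonneg hS.density.nonneg ρ 0).trans (hB 0)
  have hBv : 0 ≤ B * volume.real (Metric.closedBall (0 : E d) b) :=
    mul_nonneg hB0 measureReal_nonneg
  have hnm : Measurable fun y => ENNReal.ofReal (nearInd ρ b z y) :=
    ((measurable_nearInd ρ b).comp measurable_prodMk_left).ennreal_ofReal
  have hnX : Measurable fun ω => ENNReal.ofReal (nearInd ρ b z (X j ω)) :=
    hnm.comp (hS.measurable j)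
  have haff : ∀ r : ℝ, 0 ≤ r →
      ENNReal.ofReal (1 + 3 * r) = 1 + ENNReal.ofReal 3 * ENNReal.ofReal r := by
    intro r hr
    rw [ENNReal.ofReal_add zero_le_one (by positivity), ENNReal.ofReal_mul (by norm_num),
      ENNReal.ofReal_one]
  rw [haff _ hBv]
  calc ∫⁻ ω, ENNReal.ofReal (1 + 3 * nearInd ρ b z (X j ω)) ∂P
      = ∫⁻ ω, (1 + ENNReal.ofReal 3 * ENNReal.ofReal (nearInd ρ b z (X j ω))) ∂P :=
        lintegral_congr fun ω => haff _ (nearInd_nonneg ρ b z _)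
    _ = 1 + ENNReal.ofReal 3 * ∫⁻ ω, ENNReal.ofReal (nearInd ρ b z (X j ω)) ∂P := by
        rw [lintegral_add_left measurable_const, lintegral_const, measure_univ, mul_one,
          lintegral_const_mul _ hnX]
    _ ≤ _ := by
        gcongr
        exact hS.lintegral_nearInd_le_mul hB j z

lemma integral_degreeWeight_le (hh : IsAdmissible h) (t : ℝ) {ρ b B : ℝ}
    (hB : ∀ x, outerPart f ρ x ≤ B) (n : ℕ) :
    ∫ ω, degreeWeight ρ b n (fun i => X i ω) ∂P ≤ n * simplexIntegral h f 0 t ρ *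
      Real.exp (3 * (n * B) * volume.real (Metric.closedBall (0 : E d) b)) := by
  have hB0 : 0 ≤ B := (outerPart_nonneg hS.density.nonneg ρ 0).trans (hB 0)
  set v := volume.real (Metric.closedBall (0 : E d) b) with hv
  have hv0 : 0 ≤ v := measureReal_nonneg
  set M : ℝ := 1 + 3 * (B * v) with hM
  have hM1 : 1 ≤ M := by
    rw [hM]
    have : 0 ≤ B * v := by positivity
    linarith
  have hterm : ∀ i ∈ Finset.range n, ∫ ω, (if ρ ≤ ‖X i ω‖ then (1 : ℝ) else 0) *
      ∏ j ∈ (Finset.range n).erase i, (1 + 3 * nearInd ρ b (X i ω) (X j ω)) ∂P ≤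
        M ^ n * simplexIntegral h f 0 t ρ := by
    intro i _
    have h1 : ∀ ω, ∀ j ∈ (Finset.range n).erase i, 0 ≤ 1 + 3 * nearInd ρ b (X i ω) (X j ω) :=
      fun ω j _ => by linarith [nearInd_nonneg ρ b (X i ω) (X j ω)]
    have h2 : ∀ ω, 0 ≤ (if ρ ≤ ‖X i ω‖ then (1 : ℝ) else 0) := fun ω => by positivity
    have hout : Measurable fun y : E d => if ρ ≤ ‖y‖ then (1 : ℝ) else 0 :=
      Measurable.ite (measurableSet_le measurable_const measurable_norm) measurable_const
        measurable_const
    have hq : 0 ≤ simplexIntegral h f 0 t ρ := by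
      rw [← hS.integral_outer_eq hh t ρ i]
      exact integral_nonneg fun ω => h2 ω
    rw [integral_eq_lintegral_of_nonneg_ae
      (Eventually.of_forall fun ω => mul_nonneg (h2 ω) (Finset.prod_nonneg (h1 ω)))
      (hS.measurable_degreeTerm ρ b i _).aestronglyMeasurable]
    refine ENNReal.toReal_le_of_le_ofReal (by positivity) ?_
    have hle := lintegral_mul_prod_le hS.measurable hS.indep hout.ennreal_ofReal
      (w := fun z y => ENNReal.ofReal (1 + 3 * nearInd ρ b z y))
      ((((measurable_nearInd ρ b).const_mul 3).const_add 1).ennreal_ofReal)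
      (fun j z => hS.lintegral_nearInd_le hB j z) i ((Finset.range n).erase i)
      (Finset.notMem_erase i _)
    have hout_eq : ∫⁻ ω, ENNReal.ofReal (if ρ ≤ ‖X i ω‖ then (1 : ℝ) else 0) ∂P =
        ENNReal.ofReal (simplexIntegral h f 0 t ρ) := by
      rw [← hS.integral_outer_eq hh t ρ i, ofReal_integral_eq_lintegral_ofReal _
        (Eventually.of_forall h2)]
      simpa using hS.integrable_degreeTerm ρ b i ∅
    rw [hout_eq] at hle
    calc _ = ∫⁻ ω, ENNReal.ofReal (if ρ ≤ ‖X i ω‖ then (1 : ℝ) else 0) *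
          ∏ j ∈ (Finset.range n).erase i,
            ENNReal.ofReal (1 + 3 * nearInd ρ b (X i ω) (X j ω)) ∂P := by
          refine lintegral_congr fun ω => ?_
          rw [ENNReal.ofReal_mul (h2 ω), ENNReal.ofReal_prod_of_nonneg (h1 ω)]
      _ ≤ ENNReal.ofReal M ^ ((Finset.range n).erase i).card *
          ENNReal.ofReal (simplexIntegral h f 0 t ρ) := hle
      _ ≤ ENNReal.ofReal M ^ n * ENNReal.ofReal (simplexIntegral h f 0 t ρ) := by
          gcongr
          · exact ENNReal.one_le_ofReal.2 hM1
          · exact (Finset.card_erase_le).trans (by simp)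
      _ = _ := by
          rw [ENNReal.ofReal_mul (by positivity), ENNReal.ofReal_pow (by positivity)]
  have hexp : M ^ n ≤ Real.exp (3 * (n * B) * v) := by
    calc M ^ n ≤ Real.exp (3 * (B * v)) ^ n := by
          gcongr
          linarith [Real.add_one_le_exp (3 * (B * v))]
      _ = _ := by
          rw [← Real.exp_nat_mul]
          ring_nf
  unfold degreeWeight
  rw [integral_finsetSum _ fun i _ => hS.integrable_degreeTerm ρ b i _]
  refine (Finset.sum_le_sum hterm).trans ?_
  rw [Finset.sum_const, Finset.card_range, nsmul_eq_mul]
  rcases n.eq_zero_or_pos with rfl | hn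
  · simp
  have hq : 0 ≤ simplexIntegral h f 0 t ρ := by
    rw [← hS.integral_outer_eq hh t ρ 0]
    exact integral_nonneg fun ω => by positivity
  calc (n : ℝ) * (M ^ n * simplexIntegral h f 0 t ρ)
      = n * simplexIntegral h f 0 t ρ * M ^ n := by ring
    _ ≤ _ := by gcongr

/-- Index sets without common elements do not contribute to the variance, and the contribution of
the others is dominated by exponential weights of the degrees. -/
lemma variance_faceCount_le (hh : IsAdmissible h) {c t : ℝ}
    (hc : ∀ 𝒳 : Finset (E d), 𝒳.Nonempty → scaled h t 𝒳 ≠ 0 → ∀ x ∈ 𝒳, ∀ y ∈ 𝒳, dist x y ≤ c)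
    (ρ : ℝ) {n : ℕ} {𝓕 : Finset (Finset ℕ)} (hF : 𝓕 ⊆ (Finset.range n).powerset)
    (hne : ∀ I ∈ 𝓕, I.Nonempty) :
    Var[fun ω => faceCount h t ρ 𝓕 fun i => X i ω; P] ≤
      ∫ ω, degreeWeight ρ c n (fun i => X i ω) ∂P := by
  set g : Finset ℕ → Ω → ℝ := fun I ω => faceInd h t ρ (fun i => X i ω) I with hg
  have hL : ∀ I ∈ 𝓕, MemLp (g I) 2 P := fun I hI => hS.memLp_faceInd hh t ρ (hne I hI) 2
  have hnn : ∀ I ∈ 𝓕, ∀ ω, 0 ≤ g I ω := fun I hI ω => faceInd_nonneg hh t ρ _ (hne I hI)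
  have hmul : ∀ p ∈ 𝓕 ×ˢ 𝓕, Integrable (fun ω => g p.1 ω * g p.2 ω) P := fun p hp =>
    (hL _ (Finset.mem_product.1 hp).1).integrable_mul (hL _ (Finset.mem_product.1 hp).2)
  have hm : AEMeasurable (fun ω => ∑ I ∈ 𝓕, g I ω) P :=
    Finset.aemeasurable_fun_sum _ fun I hI => (hL I hI).aestronglyMeasurable.aemeasurable
  unfold faceCount
  change Var[fun ω => ∑ I ∈ 𝓕, g I ω; P] ≤ _
  rw [← covariance_self hm, covariance_fun_sum_fun_sum' hL hL, ← Finset.sum_product',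
    ← Finset.sum_filter_add_sum_filter_not _ fun p : Finset ℕ × Finset ℕ => Disjoint p.1 p.2]
  have hdis : ∑ p ∈ 𝓕 ×ˢ 𝓕 with Disjoint p.1 p.2, cov[g p.1, g p.2; P] = 0 := by
    refine Finset.sum_eq_zero fun p hp => ?_
    rw [Finset.mem_filter, Finset.mem_product] at hp
    exact (hS.indepFun_faceInd hh t ρ (hne _ hp.1.1) (hne _ hp.1.2) hp.2).covariance_eq_zero
      (hL _ hp.1.1) (hL _ hp.1.2)
  rw [hdis, zero_add]
  calc ∑ p ∈ 𝓕 ×ˢ 𝓕 with ¬ Disjoint p.1 p.2, cov[g p.1, g p.2; P]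
      ≤ ∑ p ∈ 𝓕 ×ˢ 𝓕 with ¬ Disjoint p.1 p.2, ∫ ω, g p.1 ω * g p.2 ω ∂P := by
        refine Finset.sum_le_sum fun p hp => ?_
        rw [Finset.mem_filter, Finset.mem_product] at hp
        rw [covariance_eq_sub (hL _ hp.1.1) (hL _ hp.1.2)]
        have h1 : 0 ≤ ∫ ω, g p.1 ω ∂P := integral_nonneg (hnn _ hp.1.1)
        have h2 : 0 ≤ ∫ ω, g p.2 ω ∂P := integral_nonneg (hnn _ hp.1.2)
        have h3 : ∫ ω, (g p.1 * g p.2) ω ∂P = ∫ ω, g p.1 ω * g p.2 ω ∂P := rfl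
        rw [h3]
        linarith [mul_nonneg h1 h2]
    _ = ∫ ω, ∑ p ∈ 𝓕 ×ˢ 𝓕 with ¬ Disjoint p.1 p.2, g p.1 ω * g p.2 ω ∂P :=
        (integral_finsetSum _ fun p hp => hmul p (Finset.mem_filter.1 hp).1).symm
    _ ≤ _ := by
        refine integral_mono (integrable_finsetSum _ fun p hp =>
          hmul p (Finset.mem_filter.1 hp).1) (hS.integrable_degreeWeight ρ c n) fun ω => ?_
        exact sum_faceInd_mul_le_degreeWeight hh hc ρ _ hF hne

lemma memLp_faceCount (hh : IsAdmissible h) (t ρ : ℝ) {𝓕 : Finset (Finset ℕ)}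
    (hne : ∀ I ∈ 𝓕, I.Nonempty) :
    MemLp (fun ω => faceCount h t ρ 𝓕 fun i => X i ω) 2 P :=
  memLp_finsetSum _ fun I hI => hS.memLp_faceInd hh t ρ (hne I hI) 2

/-- Almost surely the sample points are pairwise distinct. -/
lemma ae_injective (hd : d ≠ 0) : ∀ᵐ ω ∂P, Function.Injective fun i => X i ω := by
  classical
  have : Nonempty (Fin d) := ⟨⟨0, Nat.pos_of_ne_zero hd⟩⟩
  have hw : Measurable (Function.uncurry fun z y : E d => if y = z then (1 : ENNReal) else 0) :=
    Measurable.ite (measurableSet_eq_fun measurable_snd measurable_fst) measurable_const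
      measurable_const
  have hM : ∀ j (z : E d), ∫⁻ ω, (if X j ω = z then (1 : ENNReal) else 0) ∂P ≤ 0 := by
    intro j z
    rw [hS.lintegral_comp_sample (g := fun y => if y = z then 1 else 0)
      (hw.comp measurable_prodMk_left)]
    have hz : ∀ᵐ y : E d, y ≠ z := compl_mem_ae_iff.2 (measure_singleton z)
    refine (lintegral_congr_ae ?_).le.trans_eq lintegral_zero
    filter_upwards [hz] with y hy
    simp [hy]
  have hpair : ∀ i j, i ≠ j → ∀ᵐ ω ∂P, X i ω ≠ X j ω := by
    intro i j hij
    have hle := lintegral_mul_prod_le hS.measurable hS.indep (u := fun _ => 1) measurable_const hw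
      hM i {j} (by simpa using hij)
    simp only [Finset.prod_singleton, one_mul, Finset.card_singleton, pow_one, zero_mul] at hle
    have h0 := (lintegral_eq_zero_iff
      (hw.comp ((hS.measurable i).prodMk (hS.measurable j)))).1 (le_antisymm hle zero_le)
    filter_upwards [h0] with ω hω hc
    simp [hc] at hω
  have hall : ∀ᵐ ω ∂P, ∀ i j, i ≠ j → X i ω ≠ X j ω := by
    refine ae_all_iff.2 fun i => ae_all_iff.2 fun j => ?_
    by_cases hij : i = j
    · exact Eventually.of_forall fun ω hc => absurd hij hc
    · filter_upwards [hpair i j hij] with ω hω _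
      exact hω
  filter_upwards [hall] with ω hω i j hij
  by_contra hc
  exact hω i j hc hij

end IsSample
end GeomComplex

/-! ### Geometric blocks and almost sure convergence along sparse sequences -/

/-- Random variables with summable variances are almost surely asymptotic to their means. -/
lemma ae_tendsto_sub_integral_zero {Ω : Type*} [MeasurableSpace Ω] {P : Measure Ω}
    [IsProbabilityMeasure P] {Z : ℕ → Ω → ℝ} (hZ : ∀ j, MemLp (Z j) 2 P)
    (hV : Summable fun j => Var[Z j; P]) :
    ∀ᵐ ω ∂P, Tendsto (fun j => Z j ω - ∫ ω, Z j ω ∂P) atTop (𝓝 0) := by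
  have hm : ∀ j, AEMeasurable (fun ω => ENNReal.ofReal ((Z j ω - ∫ ω, Z j ω ∂P) ^ 2)) P := fun j =>
    (((hZ j).aestronglyMeasurable.aemeasurable.sub_const _).pow_const 2).ennreal_ofReal
  have hsum : ∫⁻ ω, ∑' j, ENNReal.ofReal ((Z j ω - ∫ ω, Z j ω ∂P) ^ 2) ∂P ≠ ⊤ := by
    rw [lintegral_tsum hm]
    have e : ∀ j, ∫⁻ ω, ENNReal.ofReal ((Z j ω - ∫ ω, Z j ω ∂P) ^ 2) ∂P =
        ENNReal.ofReal (Var[Z j; P]) := fun j => by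
      rw [ofReal_variance (hZ j), evariance_eq_lintegral_ofReal]
    simp_rw [e]
    rw [← ENNReal.ofReal_tsum_of_nonneg (fun j => variance_nonneg _ _) hV]
    exact ENNReal.ofReal_ne_top
  filter_upwards [ae_lt_top' (AEMeasurable.tsum hm) hsum] with ω hω
  have h1 := ENNReal.tendsto_atTop_zero_of_tsum_ne_top hω.ne
  have h2 := (ENNReal.tendsto_toReal ENNReal.zero_ne_top).comp h1
  simp only [Function.comp_def, ENNReal.toReal_ofReal (sq_nonneg _), ENNReal.toReal_zero] at h2
  have h3 := h2.sqrt
  simp only [Real.sqrt_sq_eq_abs, Real.sqrt_zero] at h3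
  exact (tendsto_zero_iff_abs_tendsto_zero _).2 h3

/-- The first index of the `j`-th geometric block of ratio `c`. -/
noncomputable def blockStart (c : ℝ) (j : ℕ) : ℕ := ⌈c ^ j⌉₊

lemma pow_le_blockStart (c : ℝ) (j : ℕ) : c ^ j ≤ blockStart c j := Nat.le_ceil _

lemma blockStart_mono {c : ℝ} (hc : 1 < c) : Monotone (blockStart c) := fun _ _ hij =>
  Nat.ceil_mono (pow_le_pow_right₀ hc.le hij)

lemma blockStart_pos {c : ℝ} (hc : 1 < c) (j : ℕ) : 0 < blockStart c j :=
  Nat.ceil_pos.2 (pow_pos (zero_lt_one.trans hc) j)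

lemma tendsto_blockStart {c : ℝ} (hc : 1 < c) : Tendsto (blockStart c) atTop atTop :=
  tendsto_nat_ceil_atTop.comp (tendsto_pow_atTop_atTop_of_one_lt hc)

lemma tendsto_blockStart_ratio {c : ℝ} (hc : 1 < c) :
    Tendsto (fun j => (blockStart c (j + 1) : ℝ) / blockStart c j) atTop (𝓝 c) := by
  have h1 : Tendsto (fun j => (blockStart c j : ℝ) / c ^ j) atTop (𝓝 1) :=
    (tendsto_nat_ceil_div_atTop (R := ℝ)).comp (tendsto_pow_atTop_atTop_of_one_lt hc)
  have h2 := ((h1.comp (tendsto_add_atTop_nat 1)).div h1 one_ne_zero).const_mul c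
  rw [div_one, mul_one] at h2
  refine h2.congr fun j => ?_
  have hc0 : 0 < c := zero_lt_one.trans hc
  have : 0 < (blockStart c j : ℝ) := by exact_mod_cast blockStart_pos hc j
  change c * ((blockStart c (j + 1) : ℝ) / c ^ (j + 1) / (blockStart c j / c ^ j)) = _
  rw [pow_succ]
  field_simp

lemma eventually_of_blocks {c : ℝ} (hc : 1 < c) {p : ℕ → Prop}
    (hp : ∀ᶠ j in atTop, ∀ n, blockStart c j ≤ n → n ≤ blockStart c (j + 1) → p n) :
    ∀ᶠ n in atTop, p n := by
  obtain ⟨J, hJ⟩ := eventually_atTop.1 hp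
  filter_upwards [eventually_ge_atTop (blockStart c J)] with n hn
  have hn1 : (1 : ℝ) ≤ n := by
    exact_mod_cast (Nat.succ_le_of_lt (blockStart_pos hc J)).trans hn
  obtain ⟨j, hj1, hj2⟩ := exists_nat_pow_near hn1 hc
  refine hJ j ?_ n (Nat.ceil_le.2 hj1) ?_
  · by_contra! hlt
    have h1 : c ^ (j + 1) ≤ c ^ J := pow_le_pow_right₀ hc.le hlt
    have h2 : (blockStart c J : ℝ) ≤ n := by exact_mod_cast hn
    linarith [pow_le_blockStart c J]
  · have := hj2.le.trans (pow_le_blockStart c (j + 1))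
    exact_mod_cast this

section Radii

variable {R : ℕ → ℝ} {φ : ℝ → ℝ} {α ξ c : ℝ}

/-- The radii grow at least like a power of `n`, so that negative powers of them are summable along
geometric blocks. -/
lemma summable_inv_radius_pow {d : ℕ} (hd : d ≠ 0) {f : GeomComplex.E d → ℝ}
    (hf : GeomComplex.HasRegVarProfile f φ α) (hα : 0 < α) (hR : Tendsto R atTop atTop)
    (hRξ : Tendsto (fun n : ℕ => (n : ℝ) * φ (R n)) atTop (𝓝 ξ)) (hξ : 0 < ξ) (hc : 1 < c)
    {p : ℕ → ℕ} (hp : ∀ j, blockStart c j ≤ p j) : Summable fun j => (R (p j) ^ d)⁻¹ := by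
  obtain ⟨κ, hκ, hlow⟩ := hf.exists_le_profile (lt_add_one α)
  have hp' : Tendsto p atTop atTop := tendsto_atTop_mono hp (tendsto_blockStart hc)
  have hc0 : 0 < c := zero_lt_one.trans hc
  set s : ℝ := d / (α + 1) with hs
  have hd0 : (0 : ℝ) < d := by exact_mod_cast Nat.pos_of_ne_zero hd
  have hs0 : 0 < s := by positivity
  have hgeom : Summable fun j : ℕ => (κ / (2 * ξ)) ^ (-s) * (c ^ (-s)) ^ j :=
    (summable_geometric_of_lt_one (by positivity)
      (Real.rpow_lt_one_of_one_lt_of_neg hc (by linarith))).mul_left _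
  refine summable_of_isBigO_nat hgeom (Asymptotics.IsBigO.of_bound 1 ?_)
  filter_upwards [hp'.eventually (hR.eventually hlow), hp'.eventually (hR.eventually_gt_atTop 0),
    hp'.eventually (hRξ.eventually_lt_const (show ξ < 2 * ξ by linarith))] with j h1 h2 h3
  set r := R (p j) with hr
  have hpj : c ^ j ≤ p j := (pow_le_blockStart c j).trans (by exact_mod_cast hp j)
  have hcj : 0 < c ^ j := by positivity
  have h4 : κ / (2 * ξ) * c ^ j ≤ r ^ (α + 1) := by
    have h5 : c ^ j * (κ * r ^ (-(α + 1))) ≤ 2 * ξ :=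
      (mul_le_mul hpj h1 (by positivity) (by positivity)).trans h3.le
    rw [Real.rpow_neg h2.le] at h5
    have h6 : 0 < r ^ (α + 1) := by positivity
    field_simp at h5
    rw [div_mul_eq_mul_div, div_le_iff₀ (by positivity)]
    linarith
  have h5 : (κ / (2 * ξ) * c ^ j) ^ s ≤ r ^ d := by
    calc (κ / (2 * ξ) * c ^ j) ^ s ≤ (r ^ (α + 1)) ^ s :=
          Real.rpow_le_rpow (by positivity) h4 hs0.le
      _ = r ^ d := by
          rw [← Real.rpow_mul h2.le, hs, mul_div_cancel₀ _ (by positivity), Real.rpow_natCast]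
  rw [Real.norm_of_nonneg (by positivity), Real.norm_of_nonneg (by positivity), one_mul]
  calc (r ^ d)⁻¹ ≤ ((κ / (2 * ξ) * c ^ j) ^ s)⁻¹ := by gcongr
    _ = _ := by
      rw [← Real.rpow_neg (by positivity), Real.mul_rpow (by positivity) (by positivity),
        ← Real.rpow_natCast c j, ← Real.rpow_mul hc0.le, ← Real.rpow_natCast (c ^ (-s)),
        ← Real.rpow_mul hc0.le, mul_comm (j : ℝ)]

end Radii

namespace GeomComplex

variable {d : ℕ} {h : Finset (E d) → ℝ} {Ω : Type*} [MeasurableSpace Ω] {P : Measure Ω}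
  [IsProbabilityMeasure P] {X : ℕ → Ω → E d} {f : E d → ℝ} {φ : ℝ → ℝ} {α : ℝ}

/-- As long as `n * φ ρ`, and with it the expected number of neighbours of a point outside the ball
of radius `ρ`, stays bounded, the mean degree weight is `O(ρ ^ d)`. -/
lemma exists_integral_degreeWeight_le (hS : IsSample P X f) (hf : HasRegVarProfile f φ α)
    (hh : IsAdmissible h) (hd : d ≠ 0) (hα : (d : ℝ) < α) (b U : ℝ) (hU : 0 ≤ U) :
    ∃ C : ℝ, 0 ≤ C ∧ ∀ᶠ ρ in atTop, ∀ n : ℕ, n * φ ρ ≤ U →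
      ∫ ω, degreeWeight ρ b n (fun i => X i ω) ∂P ≤ C * ρ ^ d := by
  have hα0 : 0 < α := (Nat.cast_nonneg d).trans_lt hα
  obtain ⟨B, hB1, hB⟩ := hf.exists_outerPart_le le_rfl hα0
  have hq := tendsto_simplexIntegral hh hd hf hα 0 zero_le_one
  set L := sphereArea d / (α * ((0 : ℕ) + 1) - d) * ∫ y, hZero h 0 1 y with hL
  have hL0 : 0 ≤ L := mul_nonneg (div_nonneg (sphereArea_nonneg d) (regVar_exponent_pos hα 0).le)
    (integral_nonneg fun y => hh.hZero_nonneg 0 1 y)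
  set v := volume.real (Metric.closedBall (0 : E d) b)
  have hv0 : 0 ≤ v := measureReal_nonneg
  refine ⟨(L + 1) * U * Real.exp (3 * (B * U) * v), by positivity, ?_⟩
  filter_upwards [hB, hq.eventually_lt_const (lt_add_one L), hf.eventually_pos,
    eventually_gt_atTop 0] with ρ h1 h2 h3 h4 n hn
  refine (hS.integral_degreeWeight_le hh 1 (fun x => (h1 x).2) n).trans ?_
  rw [div_lt_iff₀ (by positivity)] at h2
  have h5 : n * simplexIntegral h f 0 1 ρ ≤ (L + 1) * U * ρ ^ d := by
    calc n * simplexIntegral h f 0 1 ρ ≤ n * ((L + 1) * (ρ ^ d * φ ρ ^ (0 + 1))) := by gcongr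
      _ = (L + 1) * (n * φ ρ) * ρ ^ d := by ring
      _ ≤ _ := by gcongr
  calc _ ≤ (L + 1) * U * ρ ^ d * Real.exp (3 * (B * U) * v) := by
        refine mul_le_mul h5 (Real.exp_le_exp.2 ?_) (by positivity) (by positivity)
        have : n * (B * φ ρ) ≤ B * U := by
          calc n * (B * φ ρ) = B * (n * φ ρ) := by ring
            _ ≤ _ := by gcongr
        gcongr
    _ = _ := by ring

/-- Law of large numbers along sequences of sample sizes and radii for which `r_j ^ d`, the order of
the variances, has summable reciprocals. -/
lemma ae_tendsto_faceCount_sub (hS : IsSample P X f) (hf : HasRegVarProfile f φ α)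
    (hh : IsAdmissible h) (hd : d ≠ 0) (hα : (d : ℝ) < α) {t : ℝ} (ht : 0 ≤ t) {U : ℝ}
    {N : ℕ → ℕ} {r : ℕ → ℝ} (hr : Tendsto r atTop atTop) (hN : ∀ᶠ j in atTop, N j * φ (r j) ≤ U)
    (hsum : Summable fun j => (r j ^ d)⁻¹) {𝓕 : ℕ → Finset (Finset ℕ)}
    (hF : ∀ j, 𝓕 j ⊆ (Finset.range (N j)).powerset) (hne : ∀ j, ∀ I ∈ 𝓕 j, I.Nonempty) :
    ∀ᵐ ω ∂P, Tendsto (fun j => faceCount h t (r j) (𝓕 j) (fun i => X i ω) / r j ^ d -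
      (∫ ω, faceCount h t (r j) (𝓕 j) (fun i => X i ω) ∂P) / r j ^ d) atTop (𝓝 0) := by
  obtain ⟨c, hc, hloc⟩ := hh.exists_dist_le
  have hU : 0 ≤ U := by
    obtain ⟨j, hj⟩ := hN.exists
    exact (mul_nonneg (Nat.cast_nonneg _) (hf.nonneg _)).trans hj
  obtain ⟨C, hC, hW⟩ := exists_integral_degreeWeight_le hS hf hh hd hα (c * t) U hU
  have hL : ∀ j, MemLp (fun ω => faceCount h t (r j) (𝓕 j) (fun i => X i ω) / r j ^ d) 2 P :=
    fun j => by
      simp_rw [div_eq_inv_mul]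
      exact (hS.memLp_faceCount hh t (r j) (hne j)).const_mul _
  have hV : Summable fun j =>
      Var[fun ω => faceCount h t (r j) (𝓕 j) (fun i => X i ω) / r j ^ d; P] := by
    refine summable_of_isBigO_nat (hsum.mul_left C) (Asymptotics.IsBigO.of_bound 1 ?_)
    filter_upwards [hr.eventually hW, hN, hr.eventually_gt_atTop 0] with j h1 h2 h3
    rw [Real.norm_of_nonneg (variance_nonneg _ _), Real.norm_of_nonneg (by positivity), one_mul]
    simp_rw [div_eq_inv_mul]
    rw [variance_const_mul]
    have h4 := (hS.variance_faceCount_le hh (hloc t ht) (r j) (hF j) (hne j)).trans (h1 _ h2)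
    calc _ ≤ ((r j ^ d)⁻¹) ^ 2 * (C * r j ^ d) := by gcongr
      _ = _ := by field_simp
  filter_upwards [ae_tendsto_sub_integral_zero hL hV] with ω hω
  simp_rw [integral_div] at hω
  exact hω

end GeomComplex

namespace GeomComplex

/-! ### Strong laws for the simplex counts -/

variable {d : ℕ} {h : Finset (E d) → ℝ} {Ω : Type*} [MeasurableSpace Ω] {P : Measure Ω}
  [IsProbabilityMeasure P] {X : ℕ → Ω → E d} {f : E d → ℝ} {φ : ℝ → ℝ} {α ξ : ℝ} {R : ℕ → ℝ}

lemma exists_argmin_block (R : ℕ → ℝ) {c : ℝ} (hc : 1 < c) : ∃ m : ℕ → ℕ,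
    (∀ j, blockStart c j ≤ m j) ∧ (∀ j, m j ≤ blockStart c (j + 1)) ∧
      ∀ j n, blockStart c j ≤ n → n ≤ blockStart c (j + 1) → R (m j) ≤ R n := by
  have hne : ∀ j, (Finset.Icc (blockStart c j) (blockStart c (j + 1))).Nonempty := fun j =>
    Finset.nonempty_Icc.2 (blockStart_mono hc (Nat.le_succ j))
  choose m hm hmin using fun j => Finset.exists_min_image _ R (hne j)
  exact ⟨m, fun j => (Finset.mem_Icc.1 (hm j)).1, fun j => (Finset.mem_Icc.1 (hm j)).2,
    fun j n h1 h2 => hmin j n (Finset.mem_Icc.2 ⟨h1, h2⟩)⟩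

lemma exists_argmax_block (R : ℕ → ℝ) {c : ℝ} (hc : 1 < c) : ∃ m : ℕ → ℕ,
    (∀ j, blockStart c j ≤ m j) ∧ (∀ j, m j ≤ blockStart c (j + 1)) ∧
      ∀ j n, blockStart c j ≤ n → n ≤ blockStart c (j + 1) → R n ≤ R (m j) := by
  obtain ⟨m, h1, h2, h3⟩ := exists_argmin_block (fun n => -R n) hc
  exact ⟨m, h1, h2, fun j n h4 h5 => neg_le_neg_iff.1 (h3 j n h4 h5)⟩

lemma powersetCard_nonempty_of_mem {k n : ℕ} {I : Finset ℕ}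
    (hI : I ∈ (Finset.range n).powersetCard (k + 1)) : I.Nonempty := by
  rw [← Finset.card_pos, (Finset.mem_powersetCard.1 hI).2]
  omega

lemma powersetCard_range_subset {k n : ℕ} :
    (Finset.range n).powersetCard (k + 1) ⊆ (Finset.range n).powerset := fun _ hI =>
  Finset.mem_powerset.2 (Finset.mem_powersetCard.1 hI).1

lemma highFaces_nonempty_of_mem {K n : ℕ} {I : Finset ℕ} (hI : I ∈ highFaces K n) :
    I.Nonempty := by
  rw [← Finset.card_pos]
  have := (Finset.mem_filter.1 hI).2
  omega

lemma simplexIntegral_nonneg (hh : IsAdmissible h) (hf : ∀ x, 0 ≤ f x) (k : ℕ) (t ρ : ℝ) :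
    0 ≤ simplexIntegral h f k t ρ :=
  integral_nonneg fun x => mul_nonneg (hh.scaled_nonneg t (pointSet_nonempty x))
    (Finset.prod_nonneg fun i _ => outerPart_nonneg hf ρ (x i))

/-- The factor by which the size at the end of a block may exceed an index in the block changes the
limit `ξ` to at most `c * ξ`. -/
lemma tendsto_block_upper (hRξ : Tendsto (fun n : ℕ => (n : ℝ) * φ (R n)) atTop (𝓝 ξ))
    {c : ℝ} (hc : 1 < c) {m : ℕ → ℕ} (hm : ∀ j, blockStart c j ≤ m j) :
    Tendsto (fun j => (blockStart c (j + 1) : ℝ) / blockStart c j * (m j * φ (R (m j)))) atTop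
      (𝓝 (c * ξ)) :=
  (tendsto_blockStart_ratio hc).mul
    (hRξ.comp (tendsto_atTop_mono hm (tendsto_blockStart hc)))

lemma block_upper_le (hφ : ∀ r, 0 ≤ φ r) {c : ℝ} (hc : 1 < c) {m : ℕ → ℕ}
    (hm : ∀ j, blockStart c j ≤ m j) (j : ℕ) :
    (blockStart c (j + 1) : ℝ) * φ (R (m j)) ≤
      (blockStart c (j + 1) : ℝ) / blockStart c j * (m j * φ (R (m j))) := by
  have h1 : (0 : ℝ) < blockStart c j := by exact_mod_cast blockStart_pos hc j
  have h2 : (blockStart c j : ℝ) ≤ m j := by exact_mod_cast hm j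
  rw [div_mul_eq_mul_div, le_div_iff₀ h1]
  have := hφ (R (m j))
  calc _ = (blockStart c (j + 1) : ℝ) * (blockStart c j * φ (R (m j))) := by ring
    _ ≤ _ := by gcongr

/-- The counts with index `n` in a block are at most the count for the largest sample and the least
radius of the block; the latter also has the least normalisation. -/
lemma ae_eventually_faceCount_le (hS : IsSample P X f) (hf : HasRegVarProfile f φ α)
    (hh : IsAdmissible h) (hd : d ≠ 0) (hα : (d : ℝ) < α) (hξ : 0 < ξ)
    (hR : Tendsto R atTop atTop)
    (hRξ : Tendsto (fun n : ℕ => (n : ℝ) * φ (R n)) atTop (𝓝 ξ)) (k : ℕ) {t : ℝ} (ht : 0 ≤ t)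
    {c : ℝ} (hc : 1 < c) :
    ∀ᵐ ω ∂P, ∀ ε > 0, ∀ᶠ n in atTop,
      faceCount h t (R n) ((Finset.range n).powersetCard (k + 1)) (fun i => X i ω) / R n ^ d ≤
        c ^ (k + 1) * sLim h α ξ k t + ε := by
  obtain ⟨m, hm1, hm2, hmin⟩ := exists_argmin_block R hc
  have hmt : Tendsto m atTop atTop := tendsto_atTop_mono hm1 (tendsto_blockStart hc)
  have hr : Tendsto (fun j => R (m j)) atTop atTop := hR.comp hmt
  have hα0 : 0 < α := (Nat.cast_nonneg d).trans_lt hα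
  have hv := tendsto_block_upper hRξ hc hm1
  set v : ℕ → ℝ := fun j => (blockStart c (j + 1) : ℝ) / blockStart c j * (m j * φ (R (m j)))
    with hv_def
  have hle : ∀ j, (blockStart c (j + 1) : ℝ) * φ (R (m j)) ≤ v j := block_upper_le hf.nonneg hc hm1
  have hU : ∀ᶠ j in atTop, (blockStart c (j + 1) : ℝ) * φ (R (m j)) ≤ c * ξ + 1 := by
    filter_upwards [hv.eventually_lt_const (lt_add_one (c * ξ))] with j hj
    exact (hle j).trans hj.le
  have hq := (tendsto_simplexIntegral hh hd hf hα k ht).comp hr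
  have hlim : Tendsto (fun j => v j ^ (k + 1) / (k + 1).factorial *
      (simplexIntegral h f k t (R (m j)) / (R (m j) ^ d * φ (R (m j)) ^ (k + 1)))) atTop
        (𝓝 (c ^ (k + 1) * sLim h α ξ k t)) := by
    have := ((hv.pow (k + 1)).div_const ((k + 1).factorial : ℝ)).mul hq
    refine this.trans (le_of_eq ?_)
    congr 1
    rw [sLim_eq hh, mul_pow, mul_comm _ (α * (k + 1) - (d : ℝ)), ← div_div]
    ring
  filter_upwards [ae_tendsto_faceCount_sub hS hf hh hd hα ht hr hU
    (summable_inv_radius_pow hd hf hα0 hR hRξ hξ hc hm1)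
    (𝓕 := fun j => (Finset.range (blockStart c (j + 1))).powersetCard (k + 1))
    (fun j => powersetCard_range_subset) (fun j I hI => powersetCard_nonempty_of_mem hI)]
    with ω hω ε hε
  refine eventually_of_blocks hc ?_
  have hsum := hω.add hlim
  rw [zero_add] at hsum
  filter_upwards [hsum.eventually_lt_const (lt_add_of_pos_right _ hε),
    hr.eventually hf.eventually_pos, hr.eventually_gt_atTop 0] with j h1 h2 h3 n hn1 hn2
  have hRn := hmin j n hn1 hn2
  have hmono : faceCount h t (R n) ((Finset.range n).powersetCard (k + 1)) (fun i => X i ω) ≤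
      faceCount h t (R (m j)) ((Finset.range (blockStart c (j + 1))).powersetCard (k + 1))
        (fun i => X i ω) :=
    faceCount_mono hh ht le_rfl hRn _
      (Finset.powersetCard_mono (Finset.range_subset_range.2 hn2))
      fun I hI => powersetCard_nonempty_of_mem hI
  have hpos : 0 ≤ faceCount h t (R (m j))
      ((Finset.range (blockStart c (j + 1))).powersetCard (k + 1)) (fun i => X i ω) :=
    Finset.sum_nonneg fun I hI => faceInd_nonneg hh _ _ _ (powersetCard_nonempty_of_mem hI)
  have hexp : (∫ ω, faceCount h t (R (m j))
      ((Finset.range (blockStart c (j + 1))).powersetCard (k + 1)) (fun i => X i ω) ∂P) /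
        R (m j) ^ d ≤ v j ^ (k + 1) / (k + 1).factorial *
      (simplexIntegral h f k t (R (m j)) / (R (m j) ^ d * φ (R (m j)) ^ (k + 1))) := by
    rw [hS.integral_faceCount_powersetCard hh]
    have hQ : 0 ≤ simplexIntegral h f k t (R (m j)) / (R (m j) ^ d * φ (R (m j)) ^ (k + 1)) :=
      div_nonneg (simplexIntegral_nonneg hh hf.density_nonneg k t _) (by positivity)
    calc _ = (blockStart c (j + 1)).choose (k + 1) * φ (R (m j)) ^ (k + 1) *
          (simplexIntegral h f k t (R (m j)) / (R (m j) ^ d * φ (R (m j)) ^ (k + 1))) := by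
          field_simp
      _ ≤ (blockStart c (j + 1) : ℝ) ^ (k + 1) / (k + 1).factorial * φ (R (m j)) ^ (k + 1) *
          (simplexIntegral h f k t (R (m j)) / (R (m j) ^ d * φ (R (m j)) ^ (k + 1))) := by
          gcongr
          exact Nat.choose_le_pow_div (k + 1) _
      _ = (blockStart c (j + 1) * φ (R (m j))) ^ (k + 1) / (k + 1).factorial *
          (simplexIntegral h f k t (R (m j)) / (R (m j) ^ d * φ (R (m j)) ^ (k + 1))) := by
          rw [mul_pow]
          ring
      _ ≤ _ := by
          gcongr
          exact hle j
  calc _ ≤ faceCount h t (R (m j))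
        ((Finset.range (blockStart c (j + 1))).powersetCard (k + 1)) (fun i => X i ω) /
          R (m j) ^ d := by gcongr
    _ ≤ _ := by linarith

/-- The counts with index `n` in a block are at least the count for the smallest sample and the
largest radius of the block; the latter also has the largest normalisation. -/
lemma ae_eventually_le_faceCount (hS : IsSample P X f) (hf : HasRegVarProfile f φ α)
    (hh : IsAdmissible h) (hd : d ≠ 0) (hα : (d : ℝ) < α) (hξ : 0 < ξ)
    (hR : Tendsto R atTop atTop)
    (hRξ : Tendsto (fun n : ℕ => (n : ℝ) * φ (R n)) atTop (𝓝 ξ)) (k : ℕ) {t : ℝ} (ht : 0 ≤ t)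
    {c : ℝ} (hc : 1 < c) :
    ∀ᵐ ω ∂P, ∀ ε > 0, ∀ᶠ n in atTop, c⁻¹ ^ (k + 1) * sLim h α ξ k t - ε ≤
      faceCount h t (R n) ((Finset.range n).powersetCard (k + 1)) (fun i => X i ω) / R n ^ d := by
  obtain ⟨m, hm1, hm2, hmax⟩ := exists_argmax_block R hc
  have hmt : Tendsto m atTop atTop := tendsto_atTop_mono hm1 (tendsto_blockStart hc)
  have hr : Tendsto (fun j => R (m j)) atTop atTop := hR.comp hmt
  have hα0 : 0 < α := (Nat.cast_nonneg d).trans_lt hα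
  have ha : ∀ j, (0 : ℝ) < blockStart c j := fun j => by exact_mod_cast blockStart_pos hc j
  have hw : Tendsto (fun j => ((blockStart c (j + 1) : ℝ) / blockStart c j)⁻¹ *
      (m j * φ (R (m j)))) atTop (𝓝 (c⁻¹ * ξ)) :=
    ((tendsto_blockStart_ratio hc).inv₀ (zero_lt_one.trans hc).ne').mul (hRξ.comp hmt)
  set w : ℕ → ℝ := fun j => ((blockStart c (j + 1) : ℝ) / blockStart c j)⁻¹ * (m j * φ (R (m j)))
    with hw_def
  have hle : ∀ j, w j ≤ blockStart c j * φ (R (m j)) := by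
    intro j
    have h2 : (m j : ℝ) ≤ blockStart c (j + 1) := by exact_mod_cast hm2 j
    have := hf.nonneg (R (m j))
    have h3 := ha (j + 1)
    simp only [hw_def]
    rw [inv_div, div_mul_eq_mul_div, div_le_iff₀ h3]
    have := (ha j).le
    calc (blockStart c j : ℝ) * (m j * φ (R (m j)))
        ≤ blockStart c j * (blockStart c (j + 1) * φ (R (m j))) := by gcongr
      _ = _ := by ring
  have hU : ∀ᶠ j in atTop, (blockStart c j : ℝ) * φ (R (m j)) ≤ ξ + 1 := by
    filter_upwards [(hRξ.comp hmt).eventually_lt_const (lt_add_one ξ)] with j hj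
    refine le_trans ?_ hj.le
    have : (blockStart c j : ℝ) ≤ m j := by exact_mod_cast hm1 j
    exact mul_le_mul_of_nonneg_right this (hf.nonneg _)
  have hq := (tendsto_simplexIntegral hh hd hf hα k ht).comp hr
  have hch : Tendsto (fun j => ((blockStart c j).choose (k + 1) : ℝ) /
      (blockStart c j : ℝ) ^ (k + 1)) atTop (𝓝 (1 / (k + 1).factorial)) := by
    have h1 := (Asymptotics.isEquivalent_iff_tendsto_one ?_).1 (isEquivalent_choose (k + 1))
    · have h2 := (h1.comp (tendsto_blockStart hc)).mul_const (1 / ((k + 1).factorial : ℝ))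
      rw [one_mul] at h2
      refine h2.congr fun j => ?_
      have := ha j
      simp only [Function.comp, Pi.div_apply]
      field_simp
    · filter_upwards [eventually_gt_atTop 0] with n hn
      positivity
  have hlim : Tendsto (fun j => ((blockStart c j).choose (k + 1) : ℝ) /
      (blockStart c j : ℝ) ^ (k + 1) * w j ^ (k + 1) *
      (simplexIntegral h f k t (R (m j)) / (R (m j) ^ d * φ (R (m j)) ^ (k + 1)))) atTop
        (𝓝 (c⁻¹ ^ (k + 1) * sLim h α ξ k t)) := by
    have := (hch.mul (hw.pow (k + 1))).mul hq
    refine this.trans (le_of_eq ?_)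
    congr 1
    rw [sLim_eq hh, mul_pow, mul_comm _ (α * (k + 1) - (d : ℝ)), ← div_div]
    ring
  filter_upwards [ae_tendsto_faceCount_sub hS hf hh hd hα ht hr hU
    (summable_inv_radius_pow hd hf hα0 hR hRξ hξ hc hm1)
    (𝓕 := fun j => (Finset.range (blockStart c j)).powersetCard (k + 1))
    (fun j => powersetCard_range_subset) (fun j I hI => powersetCard_nonempty_of_mem hI)]
    with ω hω ε hε
  have hRpos : ∀ᶠ j in atTop, ∀ n, blockStart c j ≤ n → 0 < R n := by
    obtain ⟨n₀, hn₀⟩ := eventually_atTop.1 (hR.eventually_gt_atTop 0)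
    filter_upwards [(tendsto_blockStart hc).eventually_ge_atTop n₀] with j hj n hn
    exact hn₀ n (hj.trans hn)
  refine eventually_of_blocks hc ?_
  have hsum := hω.add hlim
  rw [zero_add] at hsum
  filter_upwards [hsum.eventually_const_lt (sub_lt_self _ hε), hr.eventually hf.eventually_pos,
    hr.eventually_gt_atTop 0, hRpos, hw.eventually_const_lt (show 0 < c⁻¹ * ξ by positivity)]
    with j h1 h2 h3 h4 h5 n hn1 hn2
  have hRn := hmax j n hn1 hn2
  have hRn0 := h4 n hn1
  have hmono : faceCount h t (R (m j)) ((Finset.range (blockStart c j)).powersetCard (k + 1))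
      (fun i => X i ω) ≤
        faceCount h t (R n) ((Finset.range n).powersetCard (k + 1)) (fun i => X i ω) :=
    faceCount_mono hh ht le_rfl hRn _
      (Finset.powersetCard_mono (Finset.range_subset_range.2 hn1))
      fun I hI => powersetCard_nonempty_of_mem hI
  have hpos : 0 ≤ faceCount h t (R (m j))
      ((Finset.range (blockStart c j)).powersetCard (k + 1)) (fun i => X i ω) :=
    Finset.sum_nonneg fun I hI => faceInd_nonneg hh _ _ _ (powersetCard_nonempty_of_mem hI)
  have hexp : ((blockStart c j).choose (k + 1) : ℝ) /
      (blockStart c j : ℝ) ^ (k + 1) * w j ^ (k + 1) *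
      (simplexIntegral h f k t (R (m j)) / (R (m j) ^ d * φ (R (m j)) ^ (k + 1))) ≤
      (∫ ω, faceCount h t (R (m j))
      ((Finset.range (blockStart c j)).powersetCard (k + 1)) (fun i => X i ω) ∂P) /
        R (m j) ^ d := by
    rw [hS.integral_faceCount_powersetCard hh]
    have hQ : 0 ≤ simplexIntegral h f k t (R (m j)) / (R (m j) ^ d * φ (R (m j)) ^ (k + 1)) :=
      div_nonneg (simplexIntegral_nonneg hh hf.density_nonneg k t _) (by positivity)
    have := ha j
    calc _ ≤ ((blockStart c j).choose (k + 1) : ℝ) /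
          (blockStart c j : ℝ) ^ (k + 1) * (blockStart c j * φ (R (m j))) ^ (k + 1) *
          (simplexIntegral h f k t (R (m j)) / (R (m j) ^ d * φ (R (m j)) ^ (k + 1))) := by
          gcongr
          exact hle j
      _ = _ := by
          rw [mul_pow]
          field_simp
  calc _ ≤ faceCount h t (R (m j))
        ((Finset.range (blockStart c j)).powersetCard (k + 1)) (fun i => X i ω) /
          R (m j) ^ d := by linarith
    _ ≤ _ := div_le_div₀ (hpos.trans hmono) hmono (by positivity) (by gcongr)

/-- The number of `k`-simplices, for fixed `k` and `t`, satisfies the strong law. -/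
lemma ae_tendsto_faceCount (hS : IsSample P X f) (hf : HasRegVarProfile f φ α)
    (hh : IsAdmissible h) (hd : d ≠ 0) (hα : (d : ℝ) < α) (hξ : 0 < ξ)
    (hR : Tendsto R atTop atTop)
    (hRξ : Tendsto (fun n : ℕ => (n : ℝ) * φ (R n)) atTop (𝓝 ξ)) (k : ℕ) {t : ℝ} (ht : 0 ≤ t) :
    ∀ᵐ ω ∂P, Tendsto (fun n => faceCount h t (R n) ((Finset.range n).powersetCard (k + 1))
      (fun i => X i ω) / R n ^ d) atTop (𝓝 (sLim h α ξ k t)) := by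
  set c : ℕ → ℝ := fun l => 1 + 1 / ((l : ℝ) + 1) with hc
  have hc1 : ∀ l, 1 < c l := fun l => by
    simp only [hc]
    have : (0 : ℝ) < 1 / ((l : ℝ) + 1) := by positivity
    linarith
  have hct : Tendsto c atTop (𝓝 1) := by
    have := (tendsto_one_div_add_atTop_nhds_zero_nat (𝕜 := ℝ)).const_add 1
    rwa [add_zero] at this
  have hup : Tendsto (fun l => c l ^ (k + 1) * sLim h α ξ k t) atTop (𝓝 (sLim h α ξ k t)) := by
    have := (hct.pow (k + 1)).mul_const (sLim h α ξ k t)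
    simpa using this
  have hlo : Tendsto (fun l => (c l)⁻¹ ^ (k + 1) * sLim h α ξ k t) atTop
      (𝓝 (sLim h α ξ k t)) := by
    have := ((hct.inv₀ one_ne_zero).pow (k + 1)).mul_const (sLim h α ξ k t)
    simpa using this
  filter_upwards [ae_all_iff.2 fun l => ae_eventually_faceCount_le hS hf hh hd hα hξ hR hRξ k ht
    (hc1 l), ae_all_iff.2 fun l => ae_eventually_le_faceCount hS hf hh hd hα hξ hR hRξ k ht
    (hc1 l)] with ω h1 h2
  refine tendsto_order.2 ⟨fun a ha => ?_, fun a ha => ?_⟩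
  · obtain ⟨l, hl⟩ := (hlo.eventually_const_lt ha).exists
    filter_upwards [h2 l _ (half_pos (sub_pos.2 hl))] with n hn
    linarith
  · obtain ⟨l, hl⟩ := (hup.eventually_lt_const ha).exists
    filter_upwards [h1 l _ (half_pos (sub_pos.2 hl))] with n hn
    linarith

/-- High-dimensional simplices are negligible, uniformly in all large `n`. -/
lemma exists_ae_eventually_highFaces_le (hS : IsSample P X f) (hf : HasRegVarProfile f φ α)
    (hh : IsAdmissible h) (hd : d ≠ 0) (hα : (d : ℝ) < α) (hξ : 0 < ξ)
    (hR : Tendsto R atTop atTop)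
    (hRξ : Tendsto (fun n : ℕ => (n : ℝ) * φ (R n)) atTop (𝓝 ξ)) {t : ℝ} (ht : 0 ≤ t) :
    ∃ C : ℝ, ∀ᵐ ω ∂P, ∀ K : ℕ, ∀ᶠ n in atTop,
      faceCount h t (R n) (highFaces K n) (fun i => X i ω) / R n ^ d ≤ C * (1 / 2) ^ K := by
  have hc : (1 : ℝ) < 2 := one_lt_two
  obtain ⟨m, hm1, hm2, hmin⟩ := exists_argmin_block R hc
  have hmt : Tendsto m atTop atTop := tendsto_atTop_mono hm1 (tendsto_blockStart hc)
  have hr : Tendsto (fun j => R (m j)) atTop atTop := hR.comp hmt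
  have hα0 : 0 < α := (Nat.cast_nonneg d).trans_lt hα
  have hU : ∀ᶠ j in atTop, (blockStart 2 (j + 1) : ℝ) * φ (R (m j)) ≤ 2 * ξ + 1 := by
    filter_upwards [(tendsto_block_upper hRξ hc hm1).eventually_lt_const (lt_add_one (2 * ξ))]
      with j hj
    exact (block_upper_le hf.nonneg hc hm1 j).trans hj.le
  obtain ⟨b, hb, hloc⟩ := hh.exists_dist_le
  obtain ⟨C, hC, hW⟩ :=
    exists_integral_degreeWeight_le hS hf hh hd hα (b * t) (2 * ξ + 1) (by positivity)
  refine ⟨C + 1, ae_all_iff.2 fun K => ?_⟩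
  filter_upwards [ae_tendsto_faceCount_sub hS hf hh hd hα ht hr hU
    (summable_inv_radius_pow hd hf hα0 hR hRξ hξ hc hm1)
    (𝓕 := fun j => highFaces K (blockStart 2 (j + 1)))
    (fun j => Finset.filter_subset _ _) (fun j I hI => highFaces_nonempty_of_mem hI)]
    with ω hω
  refine eventually_of_blocks hc ?_
  have hK : (0 : ℝ) < (1 / 2) ^ K := by positivity
  filter_upwards [hω.eventually_lt_const hK, hr.eventually hW, hU, hr.eventually_gt_atTop 0]
    with j h1 h2 h3 h4 n hn1 hn2
  have hRn := hmin j n hn1 hn2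
  have hsub : highFaces K n ⊆ highFaces K (blockStart 2 (j + 1)) :=
    Finset.filter_subset_filter _ (Finset.powerset_mono.2 (Finset.range_subset_range.2 hn2))
  have hmono : faceCount h t (R n) (highFaces K n) (fun i => X i ω) ≤
      faceCount h t (R (m j)) (highFaces K (blockStart 2 (j + 1))) (fun i => X i ω) :=
    faceCount_mono hh ht le_rfl hRn _ hsub fun I hI => highFaces_nonempty_of_mem hI
  have hpos : 0 ≤ faceCount h t (R (m j)) (highFaces K (blockStart 2 (j + 1)))
      (fun i => X i ω) :=
    Finset.sum_nonneg fun I hI => faceInd_nonneg hh _ _ _ (highFaces_nonempty_of_mem hI)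
  have hexp : (∫ ω, faceCount h t (R (m j)) (highFaces K (blockStart 2 (j + 1)))
      (fun i => X i ω) ∂P) / R (m j) ^ d ≤ (1 / 2) ^ K * C := by
    rw [div_le_iff₀ (by positivity)]
    calc _ ≤ ∫ ω, (1 / 2) ^ K *
          degreeWeight (R (m j)) (b * t) (blockStart 2 (j + 1)) (fun i => X i ω) ∂P := by
          refine integral_mono ?_ ?_ fun ω => ?_
          · exact (hS.memLp_faceCount hh t _ fun I hI =>
              highFaces_nonempty_of_mem hI).integrable one_le_two
          · exact (hS.integrable_degreeWeight _ _ _).const_mul _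
          · exact faceCount_highFaces_le hh (hloc t ht) _ _ _ _
      _ ≤ (1 / 2) ^ K * (C * R (m j) ^ d) := by
          rw [integral_const_mul]
          exact mul_le_mul_of_nonneg_left (h2 _ h3) hK.le
      _ = _ := by ring
  calc _ ≤ faceCount h t (R (m j)) (highFaces K (blockStart 2 (j + 1))) (fun i => X i ω) /
          R (m j) ^ d := by gcongr
    _ ≤ _ := by linarith

end GeomComplex

/-! ### Uniform convergence on compact sets -/

/-- Monotone functions converging at the rational points to a continuous function converge
uniformly on compact sets. -/
lemma tendstoUniformlyOn_of_monotoneOn {F : ℕ → ℝ → ℝ} {g : ℝ → ℝ}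
    (hF : ∀ᶠ n in atTop, MonotoneOn (F n) (Ici 0)) (hg : ContinuousOn g (Ici 0))
    (hq : ∀ q : ℚ, 0 ≤ q → Tendsto (fun n => F n q) atTop (𝓝 (g q))) (T : ℝ) :
    TendstoUniformlyOn F g atTop (Icc 0 T) := by
  rw [← tendstoLocallyUniformlyOn_iff_tendstoUniformlyOn_of_compact isCompact_Icc,
    Metric.tendstoLocallyUniformlyOn_iff]
  intro ε hε t ht
  obtain ⟨δ, hδ, hgδ⟩ := Metric.continuousWithinAt_iff.1 (hg t ht.1) (ε / 4) (by positivity)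
  obtain ⟨q₂, hq₂, hq₂'⟩ := exists_rat_btwn (show t < t + δ by linarith)
  obtain ⟨q₁, hq₁0, hq₁δ, hq₁t, hq₁⟩ : ∃ q : ℚ, 0 ≤ q ∧ t - δ < q ∧ (q : ℝ) ≤ t ∧
      Icc (q : ℝ) q₂ ∈ 𝓝[Icc 0 T] t := by
    rcases ht.1.eq_or_lt with h0 | h0
    · refine ⟨0, le_rfl, by simp; linarith, by simp [← h0], ?_⟩
      filter_upwards [self_mem_nhdsWithin, mem_nhdsWithin_of_mem_nhds (Iio_mem_nhds hq₂)]
        with y hy hy'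
      exact ⟨by simpa using hy.1, le_of_lt hy'⟩
    · obtain ⟨q, h1, h2⟩ := exists_rat_btwn (show max 0 (t - δ) < t from
        max_lt h0 (by linarith))
      refine ⟨q, ?_, (le_max_right _ _).trans_lt h1, h2.le,
        mem_nhdsWithin_of_mem_nhds (Icc_mem_nhds h2 hq₂)⟩
      exact_mod_cast (le_max_left _ _).trans h1.le
  have hq₁0' : (0 : ℝ) ≤ q₁ := by exact_mod_cast hq₁0
  have hq₂0 : (0 : ℝ) ≤ q₂ := ht.1.trans hq₂.le
  have hgnear : ∀ y : ℝ, q₁ ≤ y → y ≤ q₂ → |g y - g t| < ε / 4 := by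
    intro y h1 h2
    refine hgδ (show y ∈ Ici 0 from hq₁0'.trans h1) ?_
    rw [Real.dist_eq, abs_lt]
    constructor <;> linarith
  refine ⟨Icc q₁ q₂, hq₁, ?_⟩
  filter_upwards [hF, Metric.tendsto_nhds.1 (hq q₁ hq₁0) (ε / 4) (by positivity),
    Metric.tendsto_nhds.1 (hq q₂ (by exact_mod_cast hq₂0)) (ε / 4) (by positivity)]
    with n hn h1 h2 y hy
  have hy0 : (0 : ℝ) ≤ y := hq₁0'.trans hy.1
  have m1 := hn hq₁0' hy0 hy.1
  have m2 := hn hy0 hq₂0 hy.2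
  have g1 := hgnear q₁ le_rfl (hy.1.trans hy.2)
  have g2 := hgnear q₂ (hy.1.trans hy.2) le_rfl
  have g3 := hgnear y hy.1 hy.2
  rw [Real.dist_eq] at *
  rw [abs_lt] at *
  constructor <;> linarith

namespace GeomComplex

variable {d : ℕ} {h : Finset (E d) → ℝ}

lemma sum_faceCount_powersetCard (t ρ : ℝ) (x : ℕ → E d) (K n : ℕ) :
    ∑ k ∈ Finset.Ico K n, faceCount h t ρ ((Finset.range n).powersetCard (k + 1)) x =
      faceCount h t ρ (highFaces K n) x := by
  have hmaps : ∀ I ∈ highFaces K n, I.card - 1 ∈ Finset.Ico K n := by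
    intro I hI
    rw [highFaces, Finset.mem_filter, Finset.mem_powerset] at hI
    have := Finset.card_le_card hI.1
    rw [Finset.card_range] at this
    rw [Finset.mem_Ico]
    omega
  unfold faceCount
  rw [← Finset.sum_fiberwise_of_maps_to hmaps]
  refine Finset.sum_congr rfl fun k hk => Finset.sum_congr ?_ fun _ _ => rfl
  rw [Finset.mem_Ico] at hk
  ext I
  simp only [highFaces, Finset.mem_filter, Finset.mem_powerset, Finset.mem_powersetCard]
  constructor
  · rintro ⟨h1, h2⟩
    refine ⟨⟨h1, ?_⟩, ?_⟩ <;> omega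
  · rintro ⟨⟨h1, h2⟩, h3⟩
    exact ⟨h1, by omega⟩

/-- Convergence of the individual counts and the bound on the high-dimensional ones give uniform
convergence of the alternating sums. -/
lemma tendstoUniformlyOn_eulerChar (hh : IsAdmissible h) (hd : d ≠ 0) {α ξ : ℝ}
    (hα : (d : ℝ) < α) (hξ : 0 < ξ) {Ω : Type*} {X : ℕ → Ω → E d} {R : ℕ → ℝ}
    (hR : Tendsto R atTop atTop) {ω : Ω} (hinj : Function.Injective fun i => X i ω)
    (hS : ∀ k : ℕ, ∀ q : ℚ, 0 ≤ q → Tendsto (fun n => faceCount h q (R n)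
      ((Finset.range n).powersetCard (k + 1)) (fun i => X i ω) / R n ^ d) atTop
        (𝓝 (sLim h α ξ k q)))
    {T C : ℝ} (hC : ∀ K : ℕ, ∀ᶠ n in atTop,
      faceCount h T (R n) (highFaces K n) (fun i => X i ω) / R n ^ d ≤ C * (1 / 2) ^ K) :
    TendstoUniformlyOn (fun (n : ℕ) (t : ℝ) => eulerChar h X R n t ω / R n ^ d)
      (limitFun h α ξ) atTop (Icc 0 T) := by
  set S : ℕ → ℕ → ℝ → ℝ := fun k n t =>
    faceCount h t (R n) ((Finset.range n).powersetCard (k + 1)) (fun i => X i ω) / R n ^ d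
    with hSdef
  have hunif : ∀ k, TendstoUniformlyOn (S k) (sLim h α ξ k) atTop (Icc 0 T) := by
    intro k
    refine tendstoUniformlyOn_of_monotoneOn ?_ (continuousOn_sLim hh hd α ξ k) (hS k) T
    filter_upwards [hR.eventually_gt_atTop 0] with n hn s hs t _ hst
    simp only [hSdef]
    gcongr
    exact faceCount_mono hh hs hst le_rfl _ subset_rfl fun I hI => powersetCard_nonempty_of_mem hI
  obtain ⟨u, hu, hsu⟩ := exists_sLim_le hh hd hα hξ T
  rw [Metric.tendstoUniformlyOn_iff]
  intro ε hε
  have hCt : Tendsto (fun K : ℕ => C * (1 / 2) ^ K) atTop (𝓝 0) := by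
    have := (tendsto_pow_atTop_nhds_zero_of_lt_one (r := (1 / 2 : ℝ)) (by norm_num)
      (by norm_num)).const_mul C
    rwa [mul_zero] at this
  have hε3 : 0 < ε / 3 := by positivity
  obtain ⟨K, hK1, hK2⟩ := ((hCt.eventually_lt_const hε3).and
    ((tendsto_sum_nat_add u).eventually_lt_const hε3)).exists
  have hfin : ∀ᶠ n in atTop, ∀ k ∈ Finset.range K, ∀ t ∈ Icc 0 T,
      dist (sLim h α ξ k t) (S k n t) < ε / (3 * (K + 1)) :=
    (Finset.eventually_all _).2 fun k _ =>
      Metric.tendstoUniformlyOn_iff.1 (hunif k) _ (by positivity)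
  filter_upwards [hfin, hC K, hR.eventually_gt_atTop 0, eventually_ge_atTop K]
    with n h1 h2 h3 h4 t ht
  have hEuler : eulerChar h X R n t ω / R n ^ d =
      ∑ k ∈ Finset.range K, (-1) ^ k * S k n t + ∑ k ∈ Finset.Ico K n, (-1) ^ k * S k n t := by
    rw [eulerChar_eq_sum, Finset.sum_div, Finset.range_eq_Ico, Finset.range_eq_Ico,
      Finset.sum_Ico_consecutive _ (Nat.zero_le K) h4]
    refine Finset.sum_congr rfl fun k _ => ?_
    rw [simplexCount_eq_faceCount X (R n) k n t hinj, mul_div_assoc]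
  have hLim : limitFun h α ξ t = ∑ k ∈ Finset.range K, (-1) ^ k * sLim h α ξ k t +
      ∑' k, (-1) ^ (k + K) * sLim h α ξ (k + K) t :=
    ((summable_alternating_sLim hh hd hα hξ ht.1).sum_add_tsum_nat_add K).symm
  have hS0 : ∀ k, 0 ≤ S k n t := fun k => by
    refine div_nonneg (Finset.sum_nonneg fun I hI => faceInd_nonneg hh _ _ _ ?_) (by positivity)
    exact powersetCard_nonempty_of_mem hI
  have b1 : |∑ k ∈ Finset.range K, (-1) ^ k * sLim h α ξ k t -
      ∑ k ∈ Finset.range K, (-1) ^ k * S k n t| < ε / 3 := by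
    rw [← Finset.sum_sub_distrib]
    refine (Finset.abs_sum_le_sum_abs _ _).trans_lt ?_
    calc ∑ k ∈ Finset.range K, |(-1) ^ k * sLim h α ξ k t - (-1) ^ k * S k n t|
        ≤ ∑ k ∈ Finset.range K, ε / (3 * (K + 1)) := by
          refine Finset.sum_le_sum fun k hk => ?_
          rw [← mul_sub, abs_mul, abs_pow, abs_neg, abs_one, one_pow, one_mul]
          exact (h1 k hk t ht).le
      _ < ε / 3 := by
          rw [Finset.sum_const, Finset.card_range, nsmul_eq_mul, ← div_div, mul_div_assoc',
            div_lt_iff₀ (by positivity)]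
          nlinarith
  have b2 : |∑ k ∈ Finset.Ico K n, (-1) ^ k * S k n t| < ε / 3 := by
    refine (Finset.abs_sum_le_sum_abs _ _).trans_lt ?_
    calc ∑ k ∈ Finset.Ico K n, |(-1) ^ k * S k n t| = ∑ k ∈ Finset.Ico K n, S k n t := by
          refine Finset.sum_congr rfl fun k _ => ?_
          rw [abs_mul, abs_pow, abs_neg, abs_one, one_pow, one_mul, abs_of_nonneg (hS0 k)]
      _ = faceCount h t (R n) (highFaces K n) (fun i => X i ω) / R n ^ d := by
          rw [← sum_faceCount_powersetCard, Finset.sum_div]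
      _ ≤ faceCount h T (R n) (highFaces K n) (fun i => X i ω) / R n ^ d := by
          gcongr
          exact faceCount_mono hh ht.1 ht.2 le_rfl _ subset_rfl fun I hI =>
            highFaces_nonempty_of_mem hI
      _ < ε / 3 := h2.trans_lt hK1
  have b3 : |∑' k, (-1) ^ (k + K) * sLim h α ξ (k + K) t| < ε / 3 := by
    refine lt_of_le_of_lt ?_ hK2
    rw [← Real.norm_eq_abs]
    refine tsum_of_norm_bounded ((summable_nat_add_iff K).2 hu).hasSum fun k => ?_
    rw [Real.norm_eq_abs, abs_mul, abs_pow, abs_neg, abs_one, one_pow, one_mul,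
      abs_of_nonneg (sLim_nonneg hh hα hξ _ t)]
    exact hsu (k + K) t ht
  rw [hEuler, hLim, Real.dist_eq]
  rw [abs_lt] at *
  constructor <;> linarith

end GeomComplex

theorem theorem3p1 {Ω : Type*} [MeasurableSpace Ω] (P : Measure Ω) [IsProbabilityMeasure P]
    (d : ℕ) (hd : 2 ≤ d)
    (h : Finset (GeomComplex.E d) → ℝ) (hh : GeomComplex.IsAdmissible h)
    (f : GeomComplex.E d → ℝ) (hf : GeomComplex.IsSphericalDensity f)
    (α : ℝ) (hα : (d : ℝ) < α) (hRV : GeomComplex.HasRegVarTail f α)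
    (X : ℕ → Ω → GeomComplex.E d) (hX : ∀ i, Measurable (X i)) (hindep : iIndepFun X P)
    (hlaw : ∀ i, P.map (X i) = volume.withDensity (fun x => ENNReal.ofReal (f x)))
    (R : ℕ → ℝ) (hR : Tendsto R atTop atTop)
    (ξ : ℝ) (hξ : 0 < ξ)
    (hRξ : ∀ θ : GeomComplex.E d, ‖θ‖ = 1 →
      Tendsto (fun n : ℕ => (n : ℝ) * f (R n • θ)) atTop (𝓝 ξ)) :
    -- the integrals and the series defining the limit converge, and the limit lies in D[0, ∞)
    (∀ t : ℝ, 0 ≤ t → ∀ k : ℕ, Integrable (GeomComplex.hZero h k t)) ∧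
    (∀ t : ℝ, 0 ≤ t → Summable (fun k : ℕ => (-1 : ℝ) ^ k * GeomComplex.sLim h α ξ k t)) ∧
    GeomComplex.IsCadlag (GeomComplex.limitFun h α ξ) ∧
    -- the sample paths lie in D[0, ∞) as soon as the scaled indicators are right continuous
    ((∀ 𝒳 : Finset (GeomComplex.E d), 𝒳.Nonempty → ∀ t : ℝ, 0 < t →
        ContinuousWithinAt (fun s => GeomComplex.scaled h s 𝒳) (Ici t) t) →
      ∀ (n : ℕ) (ω : Ω), GeomComplex.IsCadlag (fun t => GeomComplex.eulerChar h X R n t ω)) ∧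
    -- almost sure convergence, uniformly on compact subsets of [0, ∞)
    (∀ᵐ ω ∂P, ∀ T : ℝ, 0 ≤ T →
      TendstoUniformlyOn (fun (n : ℕ) (t : ℝ) => GeomComplex.eulerChar h X R n t ω / R n ^ d)
        (GeomComplex.limitFun h α ξ) atTop (Icc 0 T)) := by
  have hd0 : d ≠ 0 := by omega
  have : Nonempty (Fin d) := ⟨⟨0, by omega⟩⟩
  obtain ⟨θ, hθ⟩ := exists_norm_eq (GeomComplex.E d) (zero_le_one (α := ℝ))
  set φ : ℝ → ℝ := fun r => f (r • θ) with hφ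
  have hprof : GeomComplex.HasRegVarProfile f φ α :=
    { eq_profile := fun x => hf.symm _ _ (by rw [norm_smul, hθ, norm_norm, mul_one])
      measurable := hf.measurable.comp (measurable_id.smul_const θ)
      nonneg := fun r => hf.nonneg _
      regVar := hRV θ hθ }
  have hS : GeomComplex.IsSample P X f := ⟨hX, hindep, hlaw, hf⟩
  refine ⟨fun t ht k => hh.integrable_hZero k ht,
    fun t ht => GeomComplex.summable_alternating_sLim hh hd0 hα hξ ht,
    GeomComplex.isCadlag_limitFun hh hd0 hα hξ,
    fun hc n ω => GeomComplex.isCadlag_eulerChar hh X R hc n ω, ?_⟩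
  choose C hC using fun T : ℕ => GeomComplex.exists_ae_eventually_highFaces_le hS hprof hh hd0 hα hξ
    hR (hRξ θ hθ) (Nat.cast_nonneg T)
  have hcount : ∀ᵐ ω ∂P, ∀ (k : ℕ) (q : ℚ), 0 ≤ q → Tendsto (fun n =>
      GeomComplex.faceCount h q (R n) ((Finset.range n).powersetCard (k + 1)) (fun i => X i ω) /
        R n ^ d) atTop (𝓝 (GeomComplex.sLim h α ξ k q)) := by
    refine ae_all_iff.2 fun k => ae_all_iff.2 fun q => ?_
    by_cases hq : 0 ≤ q
    · filter_upwards [GeomComplex.ae_tendsto_faceCount hS hprof hh hd0 hα hξ hR (hRξ θ hθ) k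
        (t := q) (by exact_mod_cast hq)] with ω hω _
      exact hω
    · exact Eventually.of_forall fun ω hc => absurd hc hq
  filter_upwards [hS.ae_injective hd0, hcount, ae_all_iff.2 hC] with ω hinj hω hCω T _
  exact (GeomComplex.tendstoUniformlyOn_eulerChar hh hd0 hα hξ hR hinj hω (hCω ⌈T⌉₊)).mono
    (Icc_subset_Icc_right (Nat.le_ceil T))
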